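/- Let $(\Omega,\mathcal F,\mathbf P)$ be a probability space with a filtration $(\mathcal F_t)_{t\ge 0}$. Let $(\xi_t)_{t\ge0}$ be a real white noise adapted to it, that is, independent random variables with $\xi_t$ $\mathcal F_t$-measurable, $\mathbf E\,\xi_t=0$, $\mathrm{Var}(\xi_t)=1$. Let $a$ be an $\mathcal F_0$-measurable random vector in $\mathbb R^n$, independent of $(\xi_t)_{t\ge 0}$, with $\mathbf E|a|^2<\infty$. Let $A,C,G\in\mathbb R^{n\times n}$, $b,\gamma\in\mathbb R^{n\times m}$, $\Gamma\in\mathbb R^{m\times m}$ with $G=G^\top$, $\Gamma=\Gamma^\top$. Assume that all eigenvalues of $A$ lie in the open unit disk and that the system $x_{t+1}=Ax_t+Cx_t\xi_{t+1}$ is stable in the mean-square sense: $\mathbf E|x_t|^2\to0$ for every $\mathcal F_0$-measurable square-integrable initial state independent of $(\xi_t)$. Let $H,\Theta\in\mathbb C^{n\times n}$ be symmetric ($H=H^\top$, $\Theta=\Theta^\top$) with $$A^\top HA-H+\Theta=0,\qquad \Theta-C^\top HC-G=0,$$ and put $\mathcal F(x,u)=\Re\,x^*\Theta x+2\Re\,x^*\gamma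 u+u^*\Gamma u$ for $x\in\mathbb C^n$, $u\in\mathbb C^m$. Let $\mathbf U$ be the set of deterministic sequences $u=(u_t)_{t\ge0}$ in $\mathbb R^m$ with $\sum_t|u_t|^2<\infty$. Consider the two problems of minimizing over $u\in\mathbf U$ (S) $\ \Phi(u)=\sum_{t\ge0}\mathbf E\,[x_t^\top Gx_t+2x_t^\top\gamma u_t+u_t^\top\Gamma u_t]$ subject to $x_{t+1}=Ax_t+bu_t+Cx_t\xi_{t+1}$, $x_0=a$; (D) $\ \Phi_1(u)=\sum_{t\ge0}\mathcal F(y_t,u_t)$ subject to $y_{t+1}=Ay_t+bu_t$, $y_0=\mathbf E\,a$. Then for every $u\in\mathbf U$ the expectations exist and both series converge absolutely. Problem (S) has an optimal control (a minimizer in $\mathbf U$) if and only if problem (D) has one. Furthermore, if there is a $\delta>0$ such that $$\mathcal F\big((zI-A)^{-1}bu,\,u\big)\ \ge\ \delta|u|^2\qquad\text{for all } z\in\mathbb C,\ |z|=1,\ \text{and all } u\in\mathbb C^m,$$ then (S) and (D) each have exactly one optimal control, and the two coincide. -/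

import Mathlib

open MeasureTheory ProbabilityTheory Filter Topology
open scoped Matrix

namespace LQ

section Definitions

variable {Ω : Type*} [mΩ : MeasurableSpace Ω] {n m : ℕ}

/-- Scalar discrete-time white noise adapted to the filtration `ℱ`: independent random variables
with mean zero and variance one, `ξ t` being `ℱ t`-measurable. -/
structure IsWhiteNoise (P : Measure Ω) (ℱ : Filtration ℕ mΩ) (ξ : ℕ → Ω → ℝ) : Prop where
  adapted : ∀ t, Measurable[ℱ t] (ξ t)
  indep : iIndepFun ξ P
  memLp : ∀ t, MemLp (ξ t) 2 P
  mean : ∀ t, ∫ ω, ξ t ω ∂P = 0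
  var : ∀ t, variance (ξ t) P = 1

/-- An admissible random initial state: `ℱ 0`-measurable, independent of the whole noise sequence,
with finite second moment (`v ⬝ᵥ v` is the squared Euclidean norm of the real vector `v`). -/
structure IsInitialState (P : Measure Ω) (ℱ : Filtration ℕ mΩ) (ξ : ℕ → Ω → ℝ)
    (a : Ω → Fin n → ℝ) : Prop where
  measurable : Measurable[ℱ 0] a
  indep : IndepFun a (fun ω t => ξ t ω) P
  integrable_sq : Integrable (fun ω => a ω ⬝ᵥ a ω) P

/-- The admissible controls: deterministic square-summable sequences in `ℝᵐ`. -/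
def admissible (m : ℕ) : Set (ℕ → Fin m → ℝ) :=
  {u | Summable fun t => u t ⬝ᵥ u t}

/-- The state of `x (t+1) = A x t + b u t + C x t ξ (t+1)`, `x 0 = a`. -/
def state (A : Matrix (Fin n) (Fin n) ℝ) (b : Matrix (Fin n) (Fin m) ℝ)
    (C : Matrix (Fin n) (Fin n) ℝ) (ξ : ℕ → Ω → ℝ) (a : Ω → Fin n → ℝ)
    (u : ℕ → Fin m → ℝ) : ℕ → Ω → Fin n → ℝ
  | 0 => a
  | t + 1 => fun ω => A *ᵥ state A b C ξ a u t ω + b *ᵥ u t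
      + ξ (t + 1) ω • (C *ᵥ state A b C ξ a u t ω)

/-- The state of the deterministic system `y (t+1) = A y t + b u t`, `y 0 = y₀`. -/
def detState (A : Matrix (Fin n) (Fin n) ℝ) (b : Matrix (Fin n) (Fin m) ℝ)
    (y₀ : Fin n → ℝ) (u : ℕ → Fin m → ℝ) : ℕ → Fin n → ℝ
  | 0 => y₀
  | t + 1 => A *ᵥ detState A b y₀ u t + b *ᵥ u t

/-- Mean-square stability of the uncontrolled system `x (t+1) = A x t + C x t ξ (t+1)`:
`E |x t|² → 0` for every admissible initial state. -/
def MeanSquareStable (P : Measure Ω) (ℱ : Filtration ℕ mΩ) (ξ : ℕ → Ω → ℝ)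
    (A C : Matrix (Fin n) (Fin n) ℝ) : Prop :=
  ∀ x₀ : Ω → Fin n → ℝ, IsInitialState P ℱ ξ x₀ →
    Tendsto (fun t => ∫ ω, state A (0 : Matrix (Fin n) (Fin 0) ℝ) C ξ x₀ 0 t ω
      ⬝ᵥ state A (0 : Matrix (Fin n) (Fin 0) ℝ) C ξ x₀ 0 t ω ∂P) atTop (𝓝 0)

/-- The real running cost `xᵀ G x + 2 xᵀ γ u + uᵀ Γ u`. -/
def runningCost (G : Matrix (Fin n) (Fin n) ℝ) (γ : Matrix (Fin n) (Fin m) ℝ)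
    (Γ : Matrix (Fin m) (Fin m) ℝ) (x : Fin n → ℝ) (u : Fin m → ℝ) : ℝ :=
  x ⬝ᵥ G *ᵥ x + 2 * (x ⬝ᵥ γ *ᵥ u) + u ⬝ᵥ Γ *ᵥ u

/-- The cost `Φ(u) = ∑ E [xᵀ G x + 2 xᵀ γ u + uᵀ Γ u]` of the stochastic problem. -/
noncomputable def stochCost (P : Measure Ω) (ξ : ℕ → Ω → ℝ) (a : Ω → Fin n → ℝ)
    (A : Matrix (Fin n) (Fin n) ℝ) (b : Matrix (Fin n) (Fin m) ℝ)
    (C G : Matrix (Fin n) (Fin n) ℝ) (γ : Matrix (Fin n) (Fin m) ℝ)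
    (Γ : Matrix (Fin m) (Fin m) ℝ) (u : ℕ → Fin m → ℝ) : ℝ :=
  ∑' t, ∫ ω, runningCost G γ Γ (state A b C ξ a u t ω) (u t) ∂P

/-- The symmetric complex matrices `H`, `Θ` solve the pair of Lyapunov equations
`Aᵀ H A - H + Θ = 0` and `Θ - Cᵀ H C - G = 0`. -/
structure LyapunovPair (A C G : Matrix (Fin n) (Fin n) ℝ)
    (H Θ : Matrix (Fin n) (Fin n) ℂ) : Prop where
  symm_H : H.IsSymm
  symm_Θ : Θ.IsSymm
  eq₁ : (A.map Complex.ofReal)ᵀ * H * A.map Complex.ofReal - H + Θ = 0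
  eq₂ : Θ - (C.map Complex.ofReal)ᵀ * H * C.map Complex.ofReal - G.map Complex.ofReal = 0

/-- The form `𝓕(x, u) = x* Θ x + 2 Re x* γ u + u* Γ u` on `ℂⁿ × ℂᵐ`, as a real number. -/
noncomputable def form (Θ : Matrix (Fin n) (Fin n) ℂ) (γ : Matrix (Fin n) (Fin m) ℝ)
    (Γ : Matrix (Fin m) (Fin m) ℝ) (x : Fin n → ℂ) (u : Fin m → ℂ) : ℝ :=
  (star x ⬝ᵥ Θ *ᵥ x).re + 2 * (star x ⬝ᵥ γ.map Complex.ofReal *ᵥ u).re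
    + (star u ⬝ᵥ Γ.map Complex.ofReal *ᵥ u).re

/-- The deterministic running cost at time `t`: the form `𝓕` along the real pair `(y t, u t)`. -/
noncomputable def detRunningCost (y₀ : Fin n → ℝ)
    (A : Matrix (Fin n) (Fin n) ℝ) (b : Matrix (Fin n) (Fin m) ℝ)
    (Θ : Matrix (Fin n) (Fin n) ℂ) (γ : Matrix (Fin n) (Fin m) ℝ)
    (Γ : Matrix (Fin m) (Fin m) ℝ) (u : ℕ → Fin m → ℝ) (t : ℕ) : ℝ :=
  form Θ γ Γ (fun i => (detState A b y₀ u t i : ℂ)) (fun j => (u t j : ℂ))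

/-- The cost `Φ₁(u) = ∑ [y* Θ y + 2 Re y* γ u + u* Γ u]` of the deterministic problem. -/
noncomputable def detCost (y₀ : Fin n → ℝ)
    (A : Matrix (Fin n) (Fin n) ℝ) (b : Matrix (Fin n) (Fin m) ℝ)
    (Θ : Matrix (Fin n) (Fin n) ℂ) (γ : Matrix (Fin n) (Fin m) ℝ)
    (Γ : Matrix (Fin m) (Fin m) ℝ) (u : ℕ → Fin m → ℝ) : ℝ :=
  ∑' t, detRunningCost y₀ A b Θ γ Γ u t

/-- `u` is an optimal control for the cost `J`: it is admissible and minimizes `J` over the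
admissible controls. -/
def IsOptimal (J : (ℕ → Fin m → ℝ) → ℝ) (u : ℕ → Fin m → ℝ) : Prop :=
  u ∈ admissible m ∧ ∀ v ∈ admissible m, J u ≤ J v

/-- The transfer matrix `g(z) = (z I - A)⁻¹`. -/
noncomputable def transfer (A : Matrix (Fin n) (Fin n) ℝ) (z : ℂ) : Matrix (Fin n) (Fin n) ℂ :=
  (z • (1 : Matrix (Fin n) (Fin n) ℂ) - A.map Complex.ofReal)⁻¹

/-- The strict frequency inequality: for some `δ > 0`, `𝓕(g(z) b u, u) ≥ δ |u|²` for all `z` on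
the unit circle and all `u ∈ ℂᵐ`. -/
def StrictFrequency (A : Matrix (Fin n) (Fin n) ℝ) (b : Matrix (Fin n) (Fin m) ℝ)
    (Θ : Matrix (Fin n) (Fin n) ℂ) (γ : Matrix (Fin n) (Fin m) ℝ)
    (Γ : Matrix (Fin m) (Fin m) ℝ) : Prop :=
  ∃ δ : ℝ, 0 < δ ∧ ∀ z : ℂ, ‖z‖ = 1 → ∀ u : Fin m → ℂ,
    δ * ∑ j, ‖u j‖ ^ 2 ≤
      form Θ γ Γ (transfer A z *ᵥ (b.map Complex.ofReal *ᵥ u)) u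

end Definitions

end LQ

/-!
# Reduction of a stochastic linear-quadratic problem to a deterministic one

The control is deterministic, so it interacts with the stochastic state only through the mean
`y t = E (x t)`, which is the deterministic trajectory. For a symmetric matrix `H`,
`E [x (t+1)ᵀ H x (t+1)] = E [x tᵀ (Aᵀ H A + Cᵀ H C) x t] + 2 (b u)ᵀ H A y + (b u)ᵀ H (b u)`
(`integral_quadratic_state_succ`). With the real part of the given `H`, the running cost of the
stochastic problem therefore equals the one of the deterministic problem plus the decrement of
`E [xᵀ H x] - yᵀ H y`. This telescopes, and the two costs differ by a constant
(`exists_stochCost_eq`); everything about minimisers can be read off the deterministic problem.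

Convergence rests on a quadratic Lyapunov function. Testing mean-square stability on constant
initial states shows that the iterates of `H ↦ Aᵀ H A + Cᵀ H C` at `1` tend to zero, and a partial
sum of them is a matrix `Q ≥ 1` with `Aᵀ Q A + Cᵀ Q C ≤ Q - 1` (`exists_isLyapunov`). The resulting
energy inequality makes `E |x t|²` and `|y t|²` summable for square-summable controls.

Under the frequency inequality the deterministic cost is coercive. For `N`-periodic trajectories
this is Parseval's identity for the discrete Fourier transform (`periodic_cost_ge`). A trajectory
from the origin becomes `N`-periodic after a change of its initial state which tends to zero as
`N → ∞`, so the inequality passes to all square-summable controls (`cost_zero_state_ge`). A coercive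
bounded quadratic functional on a Hilbert space has a unique minimiser, by the Lax-Milgram theorem
(`exists_optimal_of_coercive`).
-/

open MeasureTheory ProbabilityTheory Filter Topology
open scoped Matrix

namespace LQ

/-! ### Bounds for real quadratic forms -/

theorem dotProduct_self_nonneg_real {ι : Type*} [Fintype ι] (x : ι → ℝ) : 0 ≤ x ⬝ᵥ x :=
  Finset.sum_nonneg fun i _ => mul_self_nonneg (x i)

theorem abs_dotProduct_mulVec_le {ι κ : Type*} [Fintype ι] [Fintype κ] (M : Matrix ι κ ℝ)
    (x : ι → ℝ) (y : κ → ℝ) :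
    |x ⬝ᵥ M *ᵥ y| ≤ (∑ i, ∑ j, |M i j|) * (x ⬝ᵥ x + y ⬝ᵥ y) := by
  have hx : ∀ i, x i ^ 2 ≤ x ⬝ᵥ x := fun i => by
    rw [pow_two]
    exact Finset.single_le_sum (f := fun i => x i * x i) (fun i _ => mul_self_nonneg (x i))
      (Finset.mem_univ i)
  have hy : ∀ i, y i ^ 2 ≤ y ⬝ᵥ y := fun i => by
    rw [pow_two]
    exact Finset.single_le_sum (f := fun i => y i * y i) (fun i _ => mul_self_nonneg (y i))
      (Finset.mem_univ i)
  have key : ∀ i j, |x i * (M i j * y j)| ≤ |M i j| * (x ⬝ᵥ x + y ⬝ᵥ y) := fun i j => by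
    rw [abs_mul, abs_mul, mul_left_comm]
    refine mul_le_mul_of_nonneg_left ?_ (abs_nonneg _)
    nlinarith [hx i, hy j, sq_abs (x i), sq_abs (y j), sq_nonneg (|x i| - |y j|),
      sq_nonneg (x i), sq_nonneg (y j)]
  simp only [dotProduct, Matrix.mulVec] at key ⊢
  rw [Finset.sum_mul]
  refine (Finset.abs_sum_le_sum_abs _ _).trans (Finset.sum_le_sum fun i _ => ?_)
  rw [Finset.mul_sum, Finset.sum_mul]
  exact (Finset.abs_sum_le_sum_abs _ _).trans (Finset.sum_le_sum fun j _ => key i j)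

theorem exists_abs_dotProduct_mulVec_le {ι κ : Type*} [Fintype ι] [Fintype κ] (M : Matrix ι κ ℝ) :
    ∃ c : ℝ, 0 ≤ c ∧ ∀ x y, |x ⬝ᵥ M *ᵥ y| ≤ c * (x ⬝ᵥ x + y ⬝ᵥ y) :=
  ⟨_, Finset.sum_nonneg fun _ _ => Finset.sum_nonneg fun _ _ => abs_nonneg _,
    abs_dotProduct_mulVec_le M⟩

theorem mulVec_dotProduct_mulVec {ι ι' κ : Type*} [Fintype ι] [Fintype ι'] [Fintype κ]
    (A : Matrix κ ι ℝ) (B : Matrix κ ι' ℝ) (H : Matrix κ κ ℝ) (x : ι → ℝ) (y : ι' → ℝ) :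
    (A *ᵥ x) ⬝ᵥ H *ᵥ (B *ᵥ y) = x ⬝ᵥ (Aᵀ * H * B) *ᵥ y := by
  rw [← Matrix.vecMul_transpose, ← Matrix.dotProduct_mulVec]
  simp only [Matrix.mulVec_mulVec, Matrix.mul_assoc]

theorem exists_mulVec_dotProduct_self_le {ι κ : Type*} [Fintype ι] [Fintype κ] [DecidableEq ι]
    (M : Matrix ι κ ℝ) :
    ∃ c : ℝ, 0 ≤ c ∧ ∀ y, (M *ᵥ y) ⬝ᵥ (M *ᵥ y) ≤ c * (y ⬝ᵥ y) := by
  obtain ⟨c, hc, h⟩ := exists_abs_dotProduct_mulVec_le (Mᵀ * (1 : Matrix ι ι ℝ) * M)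
  refine ⟨2 * c, by positivity, fun y => ?_⟩
  have := mulVec_dotProduct_mulVec M M 1 y y
  rw [Matrix.one_mulVec] at this
  rw [this]
  linarith [h y y, le_abs_self (y ⬝ᵥ (Mᵀ * (1 : Matrix ι ι ℝ) * M) *ᵥ y)]

theorem dotProduct_mulVec_comm_of_isSymm {ι : Type*} [Fintype ι] {H : Matrix ι ι ℝ} (hH : H.IsSymm)
    (x y : ι → ℝ) : x ⬝ᵥ H *ᵥ y = y ⬝ᵥ H *ᵥ x := by
  rw [Matrix.dotProduct_mulVec, ← Matrix.mulVec_transpose, hH.eq, dotProduct_comm]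

theorem quadratic_add {ι : Type*} [Fintype ι] {H : Matrix ι ι ℝ} (hH : H.IsSymm)
    (x y : ι → ℝ) :
    (x + y) ⬝ᵥ H *ᵥ (x + y) = x ⬝ᵥ H *ᵥ x + 2 * (y ⬝ᵥ H *ᵥ x) + y ⬝ᵥ H *ᵥ y := by
  rw [Matrix.mulVec_add, add_dotProduct, dotProduct_add, dotProduct_add,
    dotProduct_mulVec_comm_of_isSymm hH x y]
  ring

theorem two_mul_dotProduct_le {ι : Type*} [Fintype ι] (x y : ι → ℝ) :
    2 * (x ⬝ᵥ y) ≤ x ⬝ᵥ x + y ⬝ᵥ y := by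
  simp only [dotProduct, Finset.mul_sum, ← Finset.sum_add_distrib]
  exact Finset.sum_le_sum fun i _ => by nlinarith [sq_nonneg (x i - y i)]

/-! ### Independence and second moments of the stochastic state -/

section Independence

variable {Ω : Type*} [mΩ : MeasurableSpace Ω] {P : Measure Ω}

/-- If `X` is independent of the pair `(Y, Z)` and `Y` is independent of `Z`, then the pair
`(X, Y)` is independent of `Z`. -/
theorem indepFun_prodMk_of_indepFun {α β γ : Type*} [MeasurableSpace α] [MeasurableSpace β]
    [MeasurableSpace γ] [IsProbabilityMeasure P] {X : Ω → α} {Y : Ω → β} {Z : Ω → γ}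
    (hX : Measurable X) (hY : Measurable Y) (hZ : Measurable Z)
    (h : IndepFun X (fun ω => (Y ω, Z ω)) P) (h' : IndepFun Y Z P) :
    IndepFun (fun ω => (X ω, Y ω)) Z P := by
  have := Measure.isProbabilityMeasure_map (μ := P) hX.aemeasurable
  have := Measure.isProbabilityMeasure_map (μ := P) hY.aemeasurable
  have := Measure.isProbabilityMeasure_map (μ := P) hZ.aemeasurable
  have hXY : IndepFun X Y P := h.comp measurable_id measurable_fst
  rw [indepFun_iff_map_prod_eq_prod_map_map hX.aemeasurable (hY.prodMk hZ).aemeasurable] at h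
  rw [indepFun_iff_map_prod_eq_prod_map_map hY.aemeasurable hZ.aemeasurable] at h'
  rw [indepFun_iff_map_prod_eq_prod_map_map hX.aemeasurable hY.aemeasurable] at hXY
  rw [indepFun_iff_map_prod_eq_prod_map_map (hX.prodMk hY).aemeasurable hZ.aemeasurable, hXY,
    ← MeasurableEquiv.prodAssoc.map_measurableEquiv_injective.eq_iff, ]
  rw [Measure.map_map MeasurableEquiv.prodAssoc.measurable ((hX.prodMk hY).prodMk hZ)]
  rw [Measure.prodAssoc_prod, ← h', ← h]
  rfl

/-- In an independent sequence, each term is independent of the sequence of later terms. -/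
theorem indepFun_tail {ξ : ℕ → Ω → ℝ} (hm : ∀ t, Measurable (ξ t)) (h : iIndepFun ξ P) (t : ℕ) :
    IndepFun (ξ t) (fun ω i => ξ (t + 1 + i) ω) P := by
  have := indep_iSup_of_disjoint (fun i => (hm i).comap_le) h.iIndep
    (S := {t}) (T := Set.Ioi t) (by simp)
  rw [IndepFun_iff_Indep]
  refine indep_of_indep_of_le_left (indep_of_indep_of_le_right this ?_) ?_
  · rw [← measurable_iff_comap_le, @measurable_pi_iff]
    intro i
    rw [measurable_iff_comap_le]
    exact le_iSup₂_of_le (t + 1 + i) (by simp; omega) le_rfl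
  · exact le_iSup₂_of_le t rfl le_rfl

end Independence

section Moments

variable {Ω : Type*} [mΩ : MeasurableSpace Ω] {P : Measure Ω} {n m : ℕ}

theorem integrable_quadratic {ι κ : Type*} [Fintype ι] [Fintype κ] {x : Ω → ι → ℝ} {y : Ω → κ → ℝ}
    (hx : ∀ i, MemLp (fun ω => x ω i) 2 P) (hy : ∀ i, MemLp (fun ω => y ω i) 2 P)
    (M : Matrix ι κ ℝ) : Integrable (fun ω => x ω ⬝ᵥ M *ᵥ y ω) P := by
  simp only [dotProduct, Matrix.mulVec]
  refine integrable_finsetSum _ fun i _ => ?_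
  have : MemLp (fun ω => ∑ j, M i j * y ω j) 2 P :=
    memLp_finsetSum _ fun j _ => (hy j).const_mul _
  exact (hx i).integrable_mul this

theorem memLp_mulVec {ι κ : Type*} [Fintype κ] {x : Ω → κ → ℝ}
    (hx : ∀ i, MemLp (fun ω => x ω i) 2 P) (M : Matrix ι κ ℝ) (i : ι) :
    MemLp (fun ω => (M *ᵥ x ω) i) 2 P :=
  memLp_finsetSum _ fun j _ => (hx j).const_mul _

theorem IsWhiteNoise.measurable {ℱ : Filtration ℕ mΩ} {ξ : ℕ → Ω → ℝ} (hξ : IsWhiteNoise P ℱ ξ)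
    (t : ℕ) : Measurable (ξ t) := (hξ.adapted t).mono (ℱ.le t) le_rfl

theorem IsInitialState.measurable' {ℱ : Filtration ℕ mΩ} {ξ : ℕ → Ω → ℝ} {a : Ω → Fin n → ℝ}
    (ha : IsInitialState P ℱ ξ a) : Measurable a := ha.measurable.mono (ℱ.le 0) le_rfl

theorem IsInitialState.memLp {ℱ : Filtration ℕ mΩ} {ξ : ℕ → Ω → ℝ} {a : Ω → Fin n → ℝ}
    (ha : IsInitialState P ℱ ξ a) (i : Fin n) : MemLp (fun ω => a ω i) 2 P := by
  have hm : Measurable fun ω => a ω i := (measurable_pi_apply i).comp ha.measurable'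
  rw [memLp_two_iff_integrable_sq hm.aestronglyMeasurable]
  refine ha.integrable_sq.mono' (hm.pow_const 2).aestronglyMeasurable (.of_forall fun ω => ?_)
  rw [Real.norm_of_nonneg (sq_nonneg _), pow_two]
  exact Finset.single_le_sum (f := fun i => a ω i * a ω i) (fun i _ => mul_self_nonneg _)
    (Finset.mem_univ i)

theorem IsWhiteNoise.integral_sq [IsProbabilityMeasure P] {ℱ : Filtration ℕ mΩ} {ξ : ℕ → Ω → ℝ}
    (hξ : IsWhiteNoise P ℱ ξ) (t : ℕ) : ∫ ω, ξ t ω ^ 2 ∂P = 1 := by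
  have := variance_eq_sub (hξ.memLp t)
  rw [hξ.var, hξ.mean] at this
  simpa using this.symm

theorem isInitialState_const [IsProbabilityMeasure P] {ℱ : Filtration ℕ mΩ} {ξ : ℕ → Ω → ℝ}
    (v : Fin n → ℝ) : IsInitialState P ℱ ξ (fun _ => v) :=
  ⟨measurable_const, indepFun_const_left _ _, integrable_const _⟩

variable (A : Matrix (Fin n) (Fin n) ℝ) (b : Matrix (Fin n) (Fin m) ℝ)
    (C : Matrix (Fin n) (Fin n) ℝ) {ξ : ℕ → Ω → ℝ} {a : Ω → Fin n → ℝ} (u : ℕ → Fin m → ℝ)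

theorem measurable_mulVec (M : Matrix (Fin n) (Fin n) ℝ) :
    Measurable fun x : Fin n → ℝ => M *ᵥ x :=
  (Continuous.matrix_mulVec continuous_const continuous_id).measurable

theorem measurable_state (hξ : ∀ t, Measurable (ξ t)) (ha : Measurable a) (t : ℕ) :
    Measurable (state A b C ξ a u t) := by
  induction t with
  | zero => exact ha
  | succ t ih =>
    exact (((measurable_mulVec A).comp ih).add_const _).add
      ((hξ _).smul ((measurable_mulVec C).comp ih))

variable [IsProbabilityMeasure P] {ℱ : Filtration ℕ mΩ} (hξ : IsWhiteNoise P ℱ ξ)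
  (ha : IsInitialState P ℱ ξ a)

include hξ ha

/-- The state at time `t` is independent of the future noise. This is the only form in which the
independence of `a` and the `ξ t` enters. -/
theorem indepFun_state_tail (t : ℕ) :
    IndepFun (state A b C ξ a u t) (fun ω i => ξ (t + 1 + i) ω) P := by
  have hm := measurable_state A b C u hξ.measurable ha.measurable'
  induction t with
  | zero =>
    exact ha.indep.comp measurable_id
      (measurable_pi_lambda (fun (s : ℕ → ℝ) i => s (0 + 1 + i)) fun i => measurable_pi_apply _)
  | succ t ih =>
    have htail : Measurable fun ω i => ξ (t + 1 + 1 + i) ω :=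
      measurable_pi_lambda _ fun i => hξ.measurable _
    have h1 := ih.comp measurable_id (ψ := fun s : ℕ → ℝ => (s 0, fun i => s (1 + i)))
      ((measurable_pi_apply 0).prodMk
        (measurable_pi_lambda (fun (s : ℕ → ℝ) i => s (1 + i)) fun i => measurable_pi_apply _))
    have h2 := indepFun_prodMk_of_indepFun (hm t) (hξ.measurable (t + 1)) htail
      (by simpa only [Function.comp_def, id, add_zero, ← add_assoc] using h1)
      (indepFun_tail hξ.measurable hξ.indep (t + 1))
    exact h2.comp (φ := fun p : (Fin n → ℝ) × ℝ => A *ᵥ p.1 + b *ᵥ u t + p.2 • (C *ᵥ p.1))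
      ((((measurable_mulVec A).comp measurable_fst).add_const _).add
        (measurable_snd.smul ((measurable_mulVec C).comp measurable_fst))) measurable_id

theorem indepFun_state_noise (t : ℕ) : IndepFun (state A b C ξ a u t) (ξ (t + 1)) P :=
  (indepFun_state_tail A b C u hξ ha t).comp measurable_id (measurable_pi_apply 0)

theorem memLp_state (t : ℕ) (i : Fin n) : MemLp (fun ω => state A b C ξ a u t ω i) 2 P := by
  have hm := measurable_state A b C u hξ.measurable ha.measurable'
  induction t generalizing i with
  | zero => exact ha.memLp i
  | succ t ih =>
    refine ((memLp_mulVec ih A i).add (memLp_const _)).add ?_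
    have hC := memLp_mulVec ih C i
    have hmC : Measurable fun x : Fin n → ℝ => (C *ᵥ x) i :=
      (measurable_pi_apply i).comp (measurable_mulVec C)
    have hind : IndepFun (fun ω => ξ (t + 1) ω ^ 2)
        (fun ω => (C *ᵥ state A b C ξ a u t ω) i ^ 2) P :=
      ((indepFun_state_noise A b C u hξ ha t).symm.comp (measurable_id.pow_const 2)
        (hmC.pow_const 2))
    have := hind.integrable_mul (hξ.memLp _).integrable_sq hC.integrable_sq
    rw [memLp_two_iff_integrable_sq]
    · simpa [mul_pow, Pi.mul_def] using this
    · exact ((hξ.measurable _).mul (hmC.comp (hm t))).aestronglyMeasurable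

/-- A product `ξ (t + 1) ^ k * f (x t)` factorises in expectation. -/
theorem integral_noise_mul (t k : ℕ) {f : (Fin n → ℝ) → ℝ} (hf : Measurable f) :
    ∫ ω, ξ (t + 1) ω ^ k * f (state A b C ξ a u t ω) ∂P
      = (∫ ω, ξ (t + 1) ω ^ k ∂P) * ∫ ω, f (state A b C ξ a u t ω) ∂P := by
  have hm := measurable_state A b C u hξ.measurable ha.measurable' t
  have : IndepFun (fun ω => ξ (t + 1) ω ^ k) (fun ω => f (state A b C ξ a u t ω)) P :=
    (indepFun_state_noise A b C u hξ ha t).symm.comp (measurable_id.pow_const k) hf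
  exact this.integral_fun_mul_eq_mul_integral
    ((hξ.measurable _).pow_const k).aestronglyMeasurable (hf.comp hm).aestronglyMeasurable

theorem integrable_noise_mul (t k : ℕ) (hk : k ≤ 2) {f : (Fin n → ℝ) → ℝ} (hf : Measurable f)
    (hi : Integrable (fun ω => f (state A b C ξ a u t ω)) P) :
    Integrable (fun ω => ξ (t + 1) ω ^ k * f (state A b C ξ a u t ω)) P := by
  have : IndepFun (fun ω => ξ (t + 1) ω ^ k) (fun ω => f (state A b C ξ a u t ω)) P :=
    (indepFun_state_noise A b C u hξ ha t).symm.comp (measurable_id.pow_const k) hf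
  refine this.integrable_mul ?_ hi
  interval_cases k
  · simp
  · simpa using (hξ.memLp (t + 1)).integrable (by norm_num)
  · exact (hξ.memLp (t + 1)).integrable_sq

/-- The mean of the stochastic state follows the deterministic system. -/
theorem integral_state (t : ℕ) :
    ∀ i, ∫ ω, state A b C ξ a u t ω i ∂P = detState A b (∫ ω, a ω ∂P) u t i := by
  have hL := fun t i => (memLp_state A b C u hξ ha t i).integrable one_le_two
  induction t with
  | zero => exact fun i => (eval_integral (fun i => hL 0 i) i).symm
  | succ t ih =>
    intro i
    have hmv : ∀ M : Matrix (Fin n) (Fin n) ℝ,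
        Integrable (fun ω => (M *ᵥ state A b C ξ a u t ω) i) P := fun M =>
      (memLp_mulVec (memLp_state A b C u hξ ha t) M i).integrable one_le_two
    have hmC : Measurable fun x : Fin n → ℝ => (C *ᵥ x) i :=
      (measurable_pi_apply i).comp (measurable_mulVec C)
    have h0 := integral_noise_mul A b C u hξ ha t 1 hmC
    have h0' := integrable_noise_mul A b C u hξ ha t 1 (by norm_num) hmC (hmv C)
    simp only [pow_one, hξ.mean, zero_mul] at h0 h0'
    have hA : ∫ ω, (A *ᵥ state A b C ξ a u t ω) i ∂P
        = (A *ᵥ detState A b (∫ ω, a ω ∂P) u t) i := by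
      simp only [Matrix.mulVec, dotProduct]
      rw [integral_finsetSum _ fun j _ => (hL t j).const_mul _]
      simp only [integral_const_mul, ih]
    simp only [state, detState, Pi.add_apply, Pi.smul_apply, smul_eq_mul]
    rw [integral_add ((hmv A).fun_add (integrable_const _)) h0', h0,
      integral_add (hmv A) (integrable_const _), hA]
    simp

/-- The second moment of the state in the metric of a symmetric matrix `H`, one step later. The
noise contributes only the term `Cᵀ H C`, and the control only interacts with the mean. -/
theorem integral_quadratic_state_succ {H : Matrix (Fin n) (Fin n) ℝ} (hH : H.IsSymm) (t : ℕ) :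
    ∫ ω, state A b C ξ a u (t + 1) ω ⬝ᵥ H *ᵥ state A b C ξ a u (t + 1) ω ∂P
      = ∫ ω, state A b C ξ a u t ω ⬝ᵥ (Aᵀ * H * A + Cᵀ * H * C) *ᵥ state A b C ξ a u t ω ∂P
        + 2 * ((b *ᵥ u t) ⬝ᵥ H *ᵥ (A *ᵥ detState A b (∫ ω, a ω ∂P) u t))
        + (b *ᵥ u t) ⬝ᵥ H *ᵥ (b *ᵥ u t) := by
  set x := state A b C ξ a u t with hx
  have hL := memLp_state A b C u hξ ha t
  rw [← hx] at hL
  -- Sorted by powers of the noise: the first power has mean zero, the second has mean one.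
  have e : ∀ ω, state A b C ξ a u (t + 1) ω ⬝ᵥ H *ᵥ state A b C ξ a u (t + 1) ω
      = x ω ⬝ᵥ (Aᵀ * H * A) *ᵥ x ω + 2 * ((b *ᵥ u t) ⬝ᵥ (H * A) *ᵥ x ω)
        + (b *ᵥ u t) ⬝ᵥ H *ᵥ (b *ᵥ u t)
        + ξ (t + 1) ω ^ 1 * (2 * ((C *ᵥ x ω) ⬝ᵥ H *ᵥ (A *ᵥ x ω + b *ᵥ u t)))
        + ξ (t + 1) ω ^ 2 * (x ω ⬝ᵥ (Cᵀ * H * C) *ᵥ x ω) := fun ω => by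
    simp only [state]
    rw [← hx, quadratic_add hH, quadratic_add hH, mulVec_dotProduct_mulVec,
      ← mulVec_dotProduct_mulVec C C]
    simp only [Matrix.mulVec_smul, smul_dotProduct, dotProduct_smul, smul_eq_mul,
      Matrix.mulVec_mulVec]
    ring
  have hconst : ∀ i, MemLp (fun _ : Ω => (b *ᵥ u t) i) 2 P := fun i => memLp_const _
  have hq : ∀ M : Matrix (Fin n) (Fin n) ℝ, Continuous fun x : Fin n → ℝ => M *ᵥ x := fun M =>
    Continuous.matrix_mulVec continuous_const continuous_id
  have i1 := integrable_quadratic hL hL (Aᵀ * H * A)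
  have i2 := (integrable_quadratic hconst hL (H * A)).const_mul 2
  have i3 : Integrable (fun _ : Ω => (b *ᵥ u t) ⬝ᵥ H *ᵥ (b *ᵥ u t)) P := integrable_const _
  have m4 : Measurable fun x : Fin n → ℝ => 2 * ((C *ᵥ x) ⬝ᵥ H *ᵥ (A *ᵥ x + b *ᵥ u t)) :=
    (continuous_const.mul ((hq C).dotProduct
      ((hq H).comp ((hq A).add continuous_const)))).measurable
  have m5 : Measurable fun x : Fin n → ℝ => x ⬝ᵥ (Cᵀ * H * C) *ᵥ x :=
    (continuous_id.dotProduct (hq _)).measurable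
  have i4 := integrable_noise_mul A b C u hξ ha t 1 (by norm_num) m4
    ((integrable_quadratic (memLp_mulVec hL C)
      (fun i => (memLp_mulVec hL A i).add (hconst i)) H).const_mul 2)
  have i5 := integrable_noise_mul A b C u hξ ha t 2 le_rfl m5
    (integrable_quadratic hL hL (Cᵀ * H * C))
  have e4 := integral_noise_mul A b C u hξ ha t 1 m4
  have e5 := integral_noise_mul A b C u hξ ha t 2 m5
  simp only [← hx] at i4 i5 e4 e5
  have e2 : ∫ ω, (b *ᵥ u t) ⬝ᵥ (H * A) *ᵥ x ω ∂P
      = (b *ᵥ u t) ⬝ᵥ H *ᵥ (A *ᵥ detState A b (∫ ω, a ω ∂P) u t) := by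
    rw [Matrix.mulVec_mulVec, Matrix.dotProduct_mulVec]
    simp only [Matrix.dotProduct_mulVec _ (H * A)]
    simp only [dotProduct]
    rw [integral_finsetSum _ fun j _ => ((hL j).integrable one_le_two).const_mul _]
    simp only [integral_const_mul, hx, integral_state A b C u hξ ha]
  simp only [e]
  rw [integral_add (((i1.fun_add i2).fun_add i3).fun_add i4) i5,
    integral_add ((i1.fun_add i2).fun_add i3) i4, integral_add (i1.fun_add i2) i3,
    integral_add i1 i2, integral_const_mul, e2, e4, e5, hξ.integral_sq]
  simp only [pow_one, hξ.mean, Matrix.add_mulVec, dotProduct_add]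
  rw [integral_add i1 (integrable_quadratic hL hL (Cᵀ * H * C))]
  simp
  ring

end Moments

/-! ### Lyapunov functions, summability and comparison of the costs -/

section Lyapunov

variable {n m : ℕ}

/-- The operator `H ↦ Aᵀ H A + Cᵀ H C`, which describes how the quadratic form
`E [xᵀ H x]` propagates along `x (t+1) = A x t + C x t ξ (t+1)`. -/
def lyapStep (A C H : Matrix (Fin n) (Fin n) ℝ) : Matrix (Fin n) (Fin n) ℝ :=
  Aᵀ * H * A + Cᵀ * H * C

theorem lyapStep_isSymm (A C : Matrix (Fin n) (Fin n) ℝ) {H : Matrix (Fin n) (Fin n) ℝ}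
    (hH : H.IsSymm) : (lyapStep A C H).IsSymm := by
  simp only [lyapStep, Matrix.IsSymm, Matrix.transpose_add, Matrix.transpose_mul,
    Matrix.transpose_transpose, hH.eq, Matrix.mul_assoc]

theorem dotProduct_lyapStep (A C H : Matrix (Fin n) (Fin n) ℝ) (v : Fin n → ℝ) :
    v ⬝ᵥ lyapStep A C H *ᵥ v = (A *ᵥ v) ⬝ᵥ H *ᵥ (A *ᵥ v) + (C *ᵥ v) ⬝ᵥ H *ᵥ (C *ᵥ v) := by
  rw [lyapStep, Matrix.add_mulVec, dotProduct_add, mulVec_dotProduct_mulVec,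
    mulVec_dotProduct_mulVec]

theorem iterate_lyapStep_isSymm (A C : Matrix (Fin n) (Fin n) ℝ) (k : ℕ) :
    ((lyapStep A C)^[k] 1).IsSymm := by
  induction k with
  | zero => exact Matrix.isSymm_one
  | succ k ih => rw [Function.iterate_succ_apply']; exact lyapStep_isSymm A C ih

theorem iterate_lyapStep_nonneg (A C : Matrix (Fin n) (Fin n) ℝ) (k : ℕ) (v : Fin n → ℝ) :
    0 ≤ v ⬝ᵥ (lyapStep A C)^[k] 1 *ᵥ v := by
  induction k generalizing v with
  | zero => simpa using dotProduct_self_nonneg_real v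
  | succ k ih =>
    rw [Function.iterate_succ_apply', dotProduct_lyapStep]
    exact add_nonneg (ih _) (ih _)

/-- Without control, a step of the state can be traded for an application of `lyapStep`. -/
theorem integral_uncontrolled_state {Ω : Type*} [mΩ : MeasurableSpace Ω] {P : Measure Ω}
    [IsProbabilityMeasure P] {ℱ : Filtration ℕ mΩ} {ξ : ℕ → Ω → ℝ} (hξ : IsWhiteNoise P ℱ ξ)
    (A C : Matrix (Fin n) (Fin n) ℝ) (v : Fin n → ℝ) (t j : ℕ) :
    ∫ ω, state A (0 : Matrix (Fin n) (Fin 0) ℝ) C ξ (fun _ => v) 0 t ω ⬝ᵥ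
      (lyapStep A C)^[j] 1 *ᵥ state A (0 : Matrix (Fin n) (Fin 0) ℝ) C ξ (fun _ => v) 0 t ω ∂P
      = v ⬝ᵥ (lyapStep A C)^[j + t] 1 *ᵥ v := by
  induction t generalizing j with
  | zero => simp [state]
  | succ t ih =>
    rw [integral_quadratic_state_succ A _ C 0 hξ (isInitialState_const v)
      (iterate_lyapStep_isSymm A C j) t, ← lyapStep, ← Function.iterate_succ_apply' (lyapStep A C),
      ih (j + 1)]
    simp [add_assoc, add_comm 1]

/-- Mean-square stability makes the iterates of `lyapStep` contract: constant initial states give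
convergence of the quadratic forms pointwise, and polarisation gives convergence of the entries. -/
theorem exists_iterate_lyapStep_le {Ω : Type*} [mΩ : MeasurableSpace Ω] {P : Measure Ω}
    [IsProbabilityMeasure P] {ℱ : Filtration ℕ mΩ} {ξ : ℕ → Ω → ℝ} (hξ : IsWhiteNoise P ℱ ξ)
    {A C : Matrix (Fin n) (Fin n) ℝ} (hstab : MeanSquareStable P ℱ ξ A C) :
    ∃ k, 0 < k ∧ ∀ v, v ⬝ᵥ (lyapStep A C)^[k] 1 *ᵥ v ≤ 1 / 2 * (v ⬝ᵥ v) := by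
  set p : ℕ → Matrix (Fin n) (Fin n) ℝ := fun k => (lyapStep A C)^[k] 1 with hp
  have hv : ∀ v, Tendsto (fun k => v ⬝ᵥ p k *ᵥ v) atTop (𝓝 0) := fun v => by
    have := hstab _ (isInitialState_const v)
    refine this.congr fun t => ?_
    simpa using integral_uncontrolled_state hξ A C v t 0
  have hij : ∀ i j, Tendsto (fun k => p k i j) atTop (𝓝 0) := fun i j => by
    have h := (((hv (Pi.single i 1 + Pi.single j 1)).sub (hv (Pi.single i 1))).sub
      (hv (Pi.single j 1))).const_mul (1 / 2)
    simp only [sub_zero, mul_zero] at h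
    refine h.congr fun k => ?_
    rw [quadratic_add (iterate_lyapStep_isSymm A C k),
      dotProduct_mulVec_comm_of_isSymm (iterate_lyapStep_isSymm A C k) (Pi.single j 1)]
    have : (Pi.single i 1 : Fin n → ℝ) ⬝ᵥ p k *ᵥ Pi.single j 1 = p k i j := by simp
    simp only [hp] at this ⊢
    rw [this]; ring
  have hsum : Tendsto (fun k => ∑ i, ∑ j, |p k i j|) atTop (𝓝 0) := by
    simpa using tendsto_finsetSum Finset.univ fun i _ =>
      tendsto_finsetSum Finset.univ fun j _ => (hij i j).abs
  obtain ⟨k, hk, hk0⟩ := ((hsum.eventually_lt_const (show (0 : ℝ) < 1 / 4 by norm_num)).and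
    (eventually_gt_atTop 0)).exists
  refine ⟨k, hk0, fun v => ?_⟩
  have h1 := (le_abs_self _).trans (abs_dotProduct_mulVec_le (p k) v v)
  nlinarith [dotProduct_self_nonneg_real v]

/-- `Q` is a quadratic Lyapunov function for the system `x (t+1) = A x t + C x t ξ (t+1)`:
`Q ≥ 1` and `Aᵀ Q A + Cᵀ Q C ≤ Q - 1` in the sense of quadratic forms. -/
structure IsLyapunov (A C Q : Matrix (Fin n) (Fin n) ℝ) : Prop where
  symm : Q.IsSymm
  le : ∀ v, v ⬝ᵥ v ≤ v ⬝ᵥ Q *ᵥ v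
  decrease : ∀ v, v ⬝ᵥ lyapStep A C Q *ᵥ v + v ⬝ᵥ v ≤ v ⬝ᵥ Q *ᵥ v

/-- A mean-square stable system has a quadratic Lyapunov function. -/
theorem exists_isLyapunov {Ω : Type*} [mΩ : MeasurableSpace Ω] {P : Measure Ω}
    [IsProbabilityMeasure P] {ℱ : Filtration ℕ mΩ} {ξ : ℕ → Ω → ℝ} (hξ : IsWhiteNoise P ℱ ξ)
    {A C : Matrix (Fin n) (Fin n) ℝ} (hstab : MeanSquareStable P ℱ ξ A C) :
    ∃ Q, IsLyapunov A C Q := by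
  obtain ⟨k, hk0, hk⟩ := exists_iterate_lyapStep_le hξ hstab
  -- The truncated Neumann series; the factor 2 turns the deficit `1 / 2` into `1`.
  let p : ℕ → Matrix (Fin n) (Fin n) ℝ := fun k => (lyapStep A C)^[k] 1
  have hQ : ∀ v, v ⬝ᵥ ((2 : ℝ) • ∑ j ∈ Finset.range k, p j) *ᵥ v
      = 2 * ∑ j ∈ Finset.range k, v ⬝ᵥ p j *ᵥ v := fun v => by
    rw [Matrix.smul_mulVec, dotProduct_smul, Matrix.sum_mulVec, dotProduct_sum, smul_eq_mul]
  have hp0 : ∀ v, v ⬝ᵥ p 0 *ᵥ v = v ⬝ᵥ v := fun v => by simp [p]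
  refine ⟨(2 : ℝ) • ∑ j ∈ Finset.range k, p j, ?_, fun v => ?_, fun v => ?_⟩
  · rw [Matrix.IsSymm, Matrix.transpose_smul, Matrix.transpose_sum]
    simp only [p, (iterate_lyapStep_isSymm A C _).eq]
  · rw [hQ]
    have := Finset.single_le_sum (f := fun j => v ⬝ᵥ p j *ᵥ v)
      (fun j _ => iterate_lyapStep_nonneg A C j v) (Finset.mem_range.2 hk0)
    simp only [hp0] at this
    linarith [dotProduct_self_nonneg_real v]
  · rw [dotProduct_lyapStep, hQ, hQ, hQ, ← mul_add, ← Finset.sum_add_distrib]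
    have hs : ∀ j, (A *ᵥ v) ⬝ᵥ p j *ᵥ (A *ᵥ v) + (C *ᵥ v) ⬝ᵥ p j *ᵥ (C *ᵥ v)
        = v ⬝ᵥ p (j + 1) *ᵥ v := fun j => by
      simp only [p]
      rw [Function.iterate_succ_apply', dotProduct_lyapStep]
    simp only [hs]
    have h1 := Finset.sum_range_succ (fun j => v ⬝ᵥ p j *ᵥ v) k
    have h2 := Finset.sum_range_succ' (fun j => v ⬝ᵥ p j *ᵥ v) k
    have h3 := hk v
    simp only [hp0] at h2
    simp only [p] at h1 h2 ⊢
    linarith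

theorem sum_le_of_decrease {W S f : ℕ → ℝ} (h : ∀ t, W (t + 1) + S t ≤ W t + f t) (N : ℕ) :
    W N + ∑ t ∈ Finset.range N, S t ≤ W 0 + ∑ t ∈ Finset.range N, f t := by
  induction N with
  | zero => simp
  | succ N ih => rw [Finset.sum_range_succ, Finset.sum_range_succ]; linarith [h N]

theorem summable_of_decrease {W S f : ℕ → ℝ} (hW : ∀ t, 0 ≤ W t) (hS : ∀ t, 0 ≤ S t)
    (hf : Summable f) (hf0 : ∀ t, 0 ≤ f t) (h : ∀ t, W (t + 1) + S t ≤ W t + f t) :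
    Summable S ∧ ∑' t, S t ≤ W 0 + ∑' t, f t := by
  have hb : ∀ N, ∑ t ∈ Finset.range N, S t ≤ W 0 + ∑' t, f t := fun N => by
    linarith [sum_le_of_decrease h N, hW N, hf.sum_le_tsum (Finset.range N) fun t _ => hf0 t]
  exact ⟨summable_of_sum_range_le hS hb, Real.tsum_le_of_sum_range_le hS hb⟩

namespace IsLyapunov

variable {A C Q : Matrix (Fin n) (Fin n) ℝ} (hQ : IsLyapunov A C Q)

include hQ

theorem nonneg (v : Fin n → ℝ) : 0 ≤ v ⬝ᵥ Q *ᵥ v := (dotProduct_self_nonneg_real v).trans (hQ.le v)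

/-- `Q` is also a Lyapunov function for the noise-free system, as `Cᵀ Q C ≥ 0`. -/
theorem decrease_det (v : Fin n → ℝ) : (A *ᵥ v) ⬝ᵥ Q *ᵥ (A *ᵥ v) + v ⬝ᵥ v ≤ v ⬝ᵥ Q *ᵥ v := by
  have := hQ.decrease v
  rw [dotProduct_lyapStep] at this
  linarith [hQ.nonneg (C *ᵥ v)]

/-- Half of the decrease of `Q` absorbs the product of the state and the control. -/
theorem exists_decrease_controlled (b : Matrix (Fin n) (Fin m) ℝ) :
    ∃ c, 0 ≤ c ∧ ∀ y u, (A *ᵥ y + b *ᵥ u) ⬝ᵥ Q *ᵥ (A *ᵥ y + b *ᵥ u) + 1 / 2 * (y ⬝ᵥ y)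
      ≤ y ⬝ᵥ Q *ᵥ y + c * (u ⬝ᵥ u) := by
  obtain ⟨c₁, h₁, H₁⟩ := exists_mulVec_dotProduct_self_le (Aᵀ * Q * b)
  obtain ⟨c₂, h₂, H₂⟩ := exists_abs_dotProduct_mulVec_le (bᵀ * Q * b)
  refine ⟨2 * c₁ + 2 * c₂, by positivity, fun y u => ?_⟩
  rw [quadratic_add hQ.symm, dotProduct_mulVec_comm_of_isSymm hQ.symm (b *ᵥ u),
    mulVec_dotProduct_mulVec A b, mulVec_dotProduct_mulVec b b]
  have h3 := two_mul_dotProduct_le y ((2 : ℝ) • ((Aᵀ * Q * b) *ᵥ u))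
  simp only [dotProduct_smul, smul_dotProduct, smul_eq_mul] at h3
  linarith [hQ.decrease_det y, H₁ u, (le_abs_self _).trans (H₂ u u)]

/-- The deterministic system maps square-summable inputs boundedly to square-summable states. -/
theorem exists_tsum_detState_le (b : Matrix (Fin n) (Fin m) ℝ) :
    ∃ c, 0 ≤ c ∧ ∀ y₀, ∀ u ∈ admissible m,
      Summable (fun t => detState A b y₀ u t ⬝ᵥ detState A b y₀ u t) ∧
      ∑' t, detState A b y₀ u t ⬝ᵥ detState A b y₀ u t ≤ c * (y₀ ⬝ᵥ y₀ + ∑' t, u t ⬝ᵥ u t) := by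
  obtain ⟨c₁, h₁, H₁⟩ := hQ.exists_decrease_controlled b
  obtain ⟨c₂, h₂, H₂⟩ := exists_abs_dotProduct_mulVec_le Q
  refine ⟨2 * c₁ + 4 * c₂, by positivity, fun y₀ u hu => ?_⟩
  have := summable_of_decrease
    (W := fun t => 2 * (detState A b y₀ u t ⬝ᵥ Q *ᵥ detState A b y₀ u t))
    (S := fun t => detState A b y₀ u t ⬝ᵥ detState A b y₀ u t)
    (f := fun t => 2 * c₁ * (u t ⬝ᵥ u t)) (fun t => mul_nonneg zero_le_two (hQ.nonneg _))
    (fun t => dotProduct_self_nonneg_real _) (hu.mul_left _)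
    (fun t => mul_nonneg (by positivity) (dotProduct_self_nonneg_real _))
    (fun t => by simp only [detState]; linarith [H₁ (detState A b y₀ u t) (u t)])
  refine ⟨this.1, this.2.trans ?_⟩
  rw [tsum_mul_left]
  simp only [detState]
  have h3 := (le_abs_self _).trans (H₂ y₀ y₀)
  have h4 : 0 ≤ ∑' t, u t ⬝ᵥ u t := tsum_nonneg fun t => dotProduct_self_nonneg_real _
  have h5 := dotProduct_self_nonneg_real y₀
  nlinarith [mul_nonneg h₁ h5, mul_nonneg h₂ h4]

theorem summable_detState (b : Matrix (Fin n) (Fin m) ℝ) (y₀ : Fin n → ℝ) {u : ℕ → Fin m → ℝ}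
    (hu : u ∈ admissible m) :
    Summable (fun t => detState A b y₀ u t ⬝ᵥ detState A b y₀ u t) := by
  obtain ⟨c, -, h⟩ := hQ.exists_tsum_detState_le b
  exact (h y₀ u hu).1

/-- Square-summable controls give summable second moments of the state. The control enters the
energy inequality through the mean only, which is already known to be square-summable. -/
theorem summable_integral_state {Ω : Type*} [mΩ : MeasurableSpace Ω] {P : Measure Ω}
    [IsProbabilityMeasure P] {ℱ : Filtration ℕ mΩ} {ξ : ℕ → Ω → ℝ} (hξ : IsWhiteNoise P ℱ ξ)
    {a : Ω → Fin n → ℝ} (ha : IsInitialState P ℱ ξ a) (b : Matrix (Fin n) (Fin m) ℝ)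
    {u : ℕ → Fin m → ℝ} (hu : u ∈ admissible m) :
    Summable (fun t => ∫ ω, state A b C ξ a u t ω ⬝ᵥ state A b C ξ a u t ω ∂P) := by
  obtain ⟨c₁, h₁, H₁⟩ := exists_abs_dotProduct_mulVec_le (bᵀ * Q * A)
  obtain ⟨c₂, h₂, H₂⟩ := exists_abs_dotProduct_mulVec_le (bᵀ * Q * b)
  have hL := memLp_state A b C u hξ ha
  have hy := hQ.summable_detState b (∫ ω, a ω ∂P) hu
  refine (summable_of_decrease
    (W := fun t => ∫ ω, state A b C ξ a u t ω ⬝ᵥ Q *ᵥ state A b C ξ a u t ω ∂P)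
    (f := fun t => 2 * c₁ * (detState A b (∫ ω, a ω ∂P) u t ⬝ᵥ detState A b (∫ ω, a ω ∂P) u t)
      + (2 * c₁ + 2 * c₂) * (u t ⬝ᵥ u t))
    (fun t => integral_nonneg fun ω => hQ.nonneg _)
    (fun t => integral_nonneg fun ω => dotProduct_self_nonneg_real _)
    ((hy.mul_left _).add (hu.mul_left _))
    (fun t => add_nonneg (mul_nonneg (by positivity) (dotProduct_self_nonneg_real _))
      (mul_nonneg (by positivity) (dotProduct_self_nonneg_real _)))
    (fun t => ?_)).1
  have hint := fun M => integrable_quadratic (hL t) (hL t) M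
  have hone := hint 1
  simp only [Matrix.one_mulVec] at hone
  rw [integral_quadratic_state_succ A b C u hξ ha hQ.symm t, mulVec_dotProduct_mulVec b A,
    mulVec_dotProduct_mulVec b b]
  have h3 : ∫ ω, state A b C ξ a u t ω ⬝ᵥ (Aᵀ * Q * A + Cᵀ * Q * C) *ᵥ state A b C ξ a u t ω ∂P
      + ∫ ω, state A b C ξ a u t ω ⬝ᵥ state A b C ξ a u t ω ∂P
      ≤ ∫ ω, state A b C ξ a u t ω ⬝ᵥ Q *ᵥ state A b C ξ a u t ω ∂P := by
    rw [← integral_add (hint _) hone]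
    exact integral_mono ((hint _).add hone) (hint _) fun ω => hQ.decrease _
  linarith [(le_abs_self _).trans (H₁ (u t) (detState A b (∫ ω, a ω ∂P) u t)),
    (le_abs_self _).trans (H₂ (u t) (u t))]

end IsLyapunov

end Lyapunov

section Costs

variable {n m : ℕ}

theorem exists_abs_runningCost_le (G : Matrix (Fin n) (Fin n) ℝ) (γ : Matrix (Fin n) (Fin m) ℝ)
    (Γ : Matrix (Fin m) (Fin m) ℝ) :
    ∃ c, 0 ≤ c ∧ ∀ x u, |runningCost G γ Γ x u| ≤ c * (x ⬝ᵥ x + u ⬝ᵥ u) := by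
  obtain ⟨c₁, h₁, H₁⟩ := exists_abs_dotProduct_mulVec_le G
  obtain ⟨c₂, h₂, H₂⟩ := exists_abs_dotProduct_mulVec_le γ
  obtain ⟨c₃, h₃, H₃⟩ := exists_abs_dotProduct_mulVec_le Γ
  refine ⟨2 * c₁ + 2 * c₂ + 2 * c₃, by positivity, fun x u => ?_⟩
  have hx := dotProduct_self_nonneg_real x
  have hu := dotProduct_self_nonneg_real u
  have h4 := abs_le.1 (H₁ x x)
  have h5 := abs_le.1 (H₂ x u)
  have h6 := abs_le.1 (H₃ u u)
  rw [runningCost, abs_le]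
  constructor <;> nlinarith [mul_nonneg h₁ hu, mul_nonneg h₃ hx]

theorem summable_runningCost (G : Matrix (Fin n) (Fin n) ℝ) (γ : Matrix (Fin n) (Fin m) ℝ)
    (Γ : Matrix (Fin m) (Fin m) ℝ) {x : ℕ → Fin n → ℝ} {u : ℕ → Fin m → ℝ}
    (hx : Summable fun t => x t ⬝ᵥ x t) (hu : u ∈ admissible m) :
    Summable fun t => runningCost G γ Γ (x t) (u t) := by
  obtain ⟨c, -, h⟩ := exists_abs_runningCost_le G γ Γ
  exact .of_norm_bounded ((hx.add hu).mul_left c) fun t => h _ _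

variable {Ω : Type*} [mΩ : MeasurableSpace Ω] {P : Measure Ω} [IsProbabilityMeasure P]
  {ℱ : Filtration ℕ mΩ} {ξ : ℕ → Ω → ℝ} (hξ : IsWhiteNoise P ℱ ξ)
  {a : Ω → Fin n → ℝ} (ha : IsInitialState P ℱ ξ a)
  (A C G : Matrix (Fin n) (Fin n) ℝ) (b γ : Matrix (Fin n) (Fin m) ℝ)
  (Γ : Matrix (Fin m) (Fin m) ℝ) {u : ℕ → Fin m → ℝ}

include hξ ha

theorem integrable_runningCost (t : ℕ) :
    Integrable (fun ω => runningCost G γ Γ (state A b C ξ a u t ω) (u t)) P := by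
  have hL := memLp_state A b C u hξ ha t
  have hc : ∀ i, MemLp (fun _ : Ω => u t i) 2 P := fun i => memLp_const _
  exact ((integrable_quadratic hL hL G).add ((integrable_quadratic hL hc γ).const_mul 2)).add
    (integrable_const _)

theorem summable_integral_runningCost {Q : Matrix (Fin n) (Fin n) ℝ} (hQ : IsLyapunov A C Q)
    (hu : u ∈ admissible m) :
    Summable fun t => ∫ ω, runningCost G γ Γ (state A b C ξ a u t ω) (u t) ∂P := by
  obtain ⟨c, -, h⟩ := exists_abs_runningCost_le G γ Γ
  refine .of_norm_bounded (((hQ.summable_integral_state hξ ha b hu).add hu).mul_left c) fun t => ?_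
  have hL := memLp_state A b C u hξ ha t
  have hone := integrable_quadratic hL hL 1
  simp only [Matrix.one_mulVec] at hone
  have hb : Integrable
      (fun ω => c * (state A b C ξ a u t ω ⬝ᵥ state A b C ξ a u t ω + u t ⬝ᵥ u t)) P :=
    (hone.add (integrable_const _)).const_mul c
  refine (norm_integral_le_integral_norm _).trans ((integral_mono
    (integrable_runningCost hξ ha A C G b γ Γ t).norm hb fun ω => h _ _).trans_eq ?_)
  rw [integral_const_mul, integral_add hone (integrable_const _)]
  simp

/-- The expected running cost differs from the deterministic one, in which `G` is replaced by
`Θ = G + Cᵀ H C`, by the decrement of `E [xᵀ H x] - yᵀ H y`, where `y = E x`. -/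
theorem integral_runningCost_eq {H Θ : Matrix (Fin n) (Fin n) ℝ} (hH : H.IsSymm)
    (h₁ : Aᵀ * H * A - H + Θ = 0) (h₂ : Θ - Cᵀ * H * C - G = 0) (t : ℕ) :
    let y := detState A b (∫ ω, a ω ∂P) u
    let D : ℕ → ℝ := fun t =>
      (∫ ω, state A b C ξ a u t ω ⬝ᵥ H *ᵥ state A b C ξ a u t ω ∂P) - y t ⬝ᵥ H *ᵥ y t
    ∫ ω, runningCost G γ Γ (state A b C ξ a u t ω) (u t) ∂P
      = runningCost Θ γ Γ (y t) (u t) + (D t - D (t + 1)) := by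
  intro y D
  have hL := memLp_state A b C u hξ ha t
  have hc : ∀ i, MemLp (fun _ : Ω => u t i) 2 P := fun i => memLp_const _
  have hint := fun M => integrable_quadratic hL hL M
  have e₁ : Θ = H - Aᵀ * H * A := by rw [← sub_eq_zero, ← h₁]; abel
  have hG : G = H - (Aᵀ * H * A + Cᵀ * H * C) := by
    have e₂ : G = Θ - Cᵀ * H * C := (sub_eq_zero.1 h₂).symm
    rw [e₂, e₁]; abel
  have hΘ : y t ⬝ᵥ Θ *ᵥ y t = y t ⬝ᵥ H *ᵥ y t - (A *ᵥ y t) ⬝ᵥ H *ᵥ (A *ᵥ y t) := by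
    rw [e₁, Matrix.sub_mulVec, dotProduct_sub, mulVec_dotProduct_mulVec]
  have hx : ∫ ω, state A b C ξ a u t ω ⬝ᵥ G *ᵥ state A b C ξ a u t ω ∂P
      = (∫ ω, state A b C ξ a u t ω ⬝ᵥ H *ᵥ state A b C ξ a u t ω ∂P)
        - ∫ ω, state A b C ξ a u t ω ⬝ᵥ (Aᵀ * H * A + Cᵀ * H * C) *ᵥ state A b C ξ a u t ω ∂P := by
    rw [hG, ← integral_sub (hint _) (hint _)]
    simp only [Matrix.sub_mulVec, dotProduct_sub]
  have hγ : ∫ ω, state A b C ξ a u t ω ⬝ᵥ γ *ᵥ u t ∂P = y t ⬝ᵥ γ *ᵥ u t := by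
    simp only [dotProduct]
    rw [integral_finsetSum _ fun i _ => ((hL i).integrable one_le_two).mul_const _]
    simp only [integral_mul_const, integral_state A b C u hξ ha, y]
  have hy : y (t + 1) = A *ᵥ y t + b *ᵥ u t := rfl
  have hD : D (t + 1) = ∫ ω, state A b C ξ a u t ω ⬝ᵥ
      (Aᵀ * H * A + Cᵀ * H * C) *ᵥ state A b C ξ a u t ω ∂P
      - (A *ᵥ y t) ⬝ᵥ H *ᵥ (A *ᵥ y t) := by
    simp only [D]
    rw [integral_quadratic_state_succ A b C u hξ ha hH, hy, quadratic_add hH]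
    simp only [y]
    ring
  rw [hD]
  simp only [runningCost, D]
  rw [integral_add ((hint G).fun_add ((integrable_quadratic hL hc γ).const_mul 2))
    (integrable_const _), integral_add (hint G) ((integrable_quadratic hL hc γ).const_mul 2),
    integral_const_mul, hγ, hx, hΘ]
  simp
  ring

/-- The stochastic and the deterministic cost differ by a constant that does not depend on the
control. -/
theorem exists_stochCost_eq {Q : Matrix (Fin n) (Fin n) ℝ} (hQ : IsLyapunov A C Q)
    {H Θ : Matrix (Fin n) (Fin n) ℝ} (hH : H.IsSymm)
    (h₁ : Aᵀ * H * A - H + Θ = 0) (h₂ : Θ - Cᵀ * H * C - G = 0) :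
    ∃ K : ℝ, ∀ u ∈ admissible m, stochCost P ξ a A b C G γ Γ u
      = ∑' t, runningCost Θ γ Γ (detState A b (∫ ω, a ω ∂P) u t) (u t) + K := by
  refine ⟨(∫ ω, a ω ⬝ᵥ H *ᵥ a ω ∂P) - (∫ ω, a ω ∂P) ⬝ᵥ H *ᵥ (∫ ω, a ω ∂P), fun u hu => ?_⟩
  have hx := hQ.summable_integral_state hξ ha b hu
  have hy := hQ.summable_detState b (∫ ω, a ω ∂P) hu
  have hS := summable_integral_runningCost hξ ha A C G b γ Γ hQ hu
  have hR := summable_runningCost Θ γ Γ hy hu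
  have e := integral_runningCost_eq hξ ha A C G b γ Γ (u := u) hH h₁ h₂
  set y := detState A b (∫ ω, a ω ∂P) u with hy_def
  let D : ℕ → ℝ := fun t =>
    (∫ ω, state A b C ξ a u t ω ⬝ᵥ H *ᵥ state A b C ξ a u t ω ∂P) - y t ⬝ᵥ H *ᵥ y t
  have hD0 : Tendsto D atTop (𝓝 0) := by
    obtain ⟨c, -, hc⟩ := exists_abs_dotProduct_mulVec_le H
    have hx0 := (hx.tendsto_atTop_zero.const_mul (2 * c)).add
      (hy.tendsto_atTop_zero.const_mul (2 * c))
    simp only [mul_zero, add_zero] at hx0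
    refine squeeze_zero_norm (fun t => ?_) hx0
    have hL := memLp_state A b C u hξ ha t
    have hone := integrable_quadratic hL hL 1
    simp only [Matrix.one_mulVec] at hone
    refine (norm_sub_le _ _).trans (add_le_add ?_ ?_)
    · rw [← integral_const_mul]
      refine (norm_integral_le_integral_norm _).trans (integral_mono
        (integrable_quadratic hL hL H).norm (hone.const_mul _) fun ω => ?_)
      exact (hc _ _).trans_eq (by ring)
    · exact (hc _ _).trans_eq (by ring)
  have hsum : Summable fun t => D t - D (t + 1) := by
    refine (hS.sub hR).congr fun t => ?_
    rw [e t]; simp [D]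
  have htel : ∑' t, (D t - D (t + 1)) = D 0 := by
    refine tendsto_nhds_unique hsum.hasSum.tendsto_sum_nat ?_
    simp only [Finset.sum_range_sub']
    simpa using hD0.const_sub (D 0)
  rw [stochCost, tsum_congr e, hR.tsum_add hsum, htel]
  rfl

end Costs

/-! ### Discrete Fourier transform and the frequency inequality -/

section Fourier

open scoped ComplexConjugate

/-- The discrete Fourier transform of the first `N` terms of a real vector sequence, with respect
to a complex number `ζ` that is meant to be a primitive `N`-th root of unity. -/
noncomputable def dft {ι : Type*} (ζ : ℂ) (N : ℕ) (x : ℕ → ι → ℝ) (k : ℕ) (i : ι) : ℂ :=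
  ∑ t ∈ Finset.range N, (ζ ^ k) ^ t * (x t i : ℂ)

/-- Orthogonality of the characters `k ↦ (ζ ^ k) ^ s`. -/
theorem sum_conj_pow_mul_pow {ζ : ℂ} {N : ℕ} (hζ : IsPrimitiveRoot ζ N) {s t : ℕ} (hs : s < N)
    (ht : t < N) :
    ∑ k ∈ Finset.range N, conj ((ζ ^ k) ^ s) * (ζ ^ k) ^ t = if s = t then (N : ℂ) else 0 := by
  have hN : N ≠ 0 := by omega
  have hconj : conj ζ = ζ⁻¹ := (Complex.inv_eq_conj (hζ.norm'_eq_one hN)).symm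
  have hζ0 : ζ ≠ 0 := hζ.ne_zero hN
  have e : ∀ k, conj ((ζ ^ k) ^ s) * (ζ ^ k) ^ t = (ζ ^ t * (ζ ^ s)⁻¹) ^ k := fun k => by
    rw [map_pow, map_pow, hconj, mul_pow, inv_pow, inv_pow, inv_pow, ← pow_mul, ← pow_mul,
      ← pow_mul, ← pow_mul, mul_comm k s, mul_comm k t, mul_comm]
  simp only [e]
  split_ifs with h
  · subst h
    simp [hζ0]
  · have h1 : ζ ^ t * (ζ ^ s)⁻¹ ≠ 1 := fun h' => h
      (hζ.pow_inj hs ht ((mul_inv_eq_one₀ (pow_ne_zero _ hζ0)).1 h').symm)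
    rw [geom_sum_eq h1, mul_pow, inv_pow, ← pow_mul, ← pow_mul, mul_comm t, mul_comm s, pow_mul,
      pow_mul, hζ.pow_eq_one]
    simp

theorem sum_conj_dft_mul_dft {ι κ : Type*} {ζ : ℂ} {N : ℕ} (hζ : IsPrimitiveRoot ζ N)
    (x : ℕ → ι → ℝ) (y : ℕ → κ → ℝ) (i : ι) (j : κ) :
    ∑ k ∈ Finset.range N, conj (dft ζ N x k i) * dft ζ N y k j
      = N * ∑ t ∈ Finset.range N, (x t i : ℂ) * (y t j : ℂ) := by
  have e : ∀ k, conj (dft ζ N x k i) * dft ζ N y k j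
      = ∑ s ∈ Finset.range N, ∑ t ∈ Finset.range N,
        (x s i : ℂ) * (y t j : ℂ) * (conj ((ζ ^ k) ^ s) * (ζ ^ k) ^ t) := fun k => by
    rw [dft, dft, map_sum, Finset.sum_mul_sum]
    refine Finset.sum_congr rfl fun s _ => Finset.sum_congr rfl fun t _ => ?_
    rw [map_mul, Complex.conj_ofReal]
    ring
  simp only [e]
  rw [Finset.sum_comm, Finset.mul_sum]
  refine Finset.sum_congr rfl fun s hs => ?_
  rw [Finset.sum_comm]
  have e2 : ∀ t ∈ Finset.range N, ∑ k ∈ Finset.range N,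
      (x s i : ℂ) * (y t j : ℂ) * (conj ((ζ ^ k) ^ s) * (ζ ^ k) ^ t)
      = if s = t then (N : ℂ) * ((x s i : ℂ) * (y t j : ℂ)) else 0 := fun t ht => by
    rw [← Finset.mul_sum, sum_conj_pow_mul_pow hζ (Finset.mem_range.1 hs) (Finset.mem_range.1 ht)]
    split_ifs <;> ring
  rw [Finset.sum_congr rfl e2, Finset.sum_ite_eq, if_pos hs]

/-- Parseval's identity for a sesquilinear form. -/
theorem sum_star_dft_dotProduct {ι κ : Type*} [Fintype ι] [Fintype κ] {ζ : ℂ} {N : ℕ}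
    (hζ : IsPrimitiveRoot ζ N) (M : Matrix ι κ ℂ) (x : ℕ → ι → ℝ) (y : ℕ → κ → ℝ) :
    ∑ k ∈ Finset.range N, star (dft ζ N x k) ⬝ᵥ M *ᵥ dft ζ N y k
      = N * ∑ t ∈ Finset.range N,
        star (fun i => (x t i : ℂ)) ⬝ᵥ M *ᵥ (fun j => (y t j : ℂ)) := by
  simp only [dotProduct, Matrix.mulVec, Pi.star_apply, Finset.mul_sum]
  rw [Finset.sum_comm]
  rw [Finset.sum_comm (s := Finset.range N)]
  refine Finset.sum_congr rfl fun i _ => ?_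
  rw [Finset.sum_comm]
  rw [Finset.sum_comm (s := Finset.range N)]
  refine Finset.sum_congr rfl fun j _ => ?_
  have := congrArg (M i j * ·) (sum_conj_dft_mul_dft hζ x y i j)
  simp only [Finset.mul_sum] at this
  refine Eq.trans (Finset.sum_congr rfl fun k _ => ?_)
    (this.trans (Finset.sum_congr rfl fun t _ => ?_))
  · rw [Complex.star_def]; ring
  · rw [Complex.star_def, Complex.conj_ofReal]; ring

theorem sum_form_dft {n m : ℕ} {ζ : ℂ} {N : ℕ} (hζ : IsPrimitiveRoot ζ N)
    (Θ : Matrix (Fin n) (Fin n) ℂ) (γ : Matrix (Fin n) (Fin m) ℝ) (Γ : Matrix (Fin m) (Fin m) ℝ)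
    (y : ℕ → Fin n → ℝ) (u : ℕ → Fin m → ℝ) :
    ∑ k ∈ Finset.range N, form Θ γ Γ (dft ζ N y k) (dft ζ N u k)
      = N * ∑ t ∈ Finset.range N, form Θ γ Γ (fun i => (y t i : ℂ)) (fun j => (u t j : ℂ)) := by
  have h : ∀ z : ℂ, ((N : ℂ) * z).re = N * z.re := fun z => by simp
  simp only [form, Finset.sum_add_distrib, ← Finset.mul_sum, ← Complex.re_sum,
    sum_star_dft_dotProduct hζ, h]
  ring

theorem sum_norm_dft_sq {m : ℕ} {ζ : ℂ} {N : ℕ} (hζ : IsPrimitiveRoot ζ N) (u : ℕ → Fin m → ℝ) :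
    ∑ k ∈ Finset.range N, ∑ j, ‖dft ζ N u k j‖ ^ 2 = N * ∑ t ∈ Finset.range N, u t ⬝ᵥ u t := by
  have h := sum_star_dft_dotProduct hζ (1 : Matrix (Fin m) (Fin m) ℂ) u u
  simp only [Matrix.one_mulVec, dotProduct, Pi.star_apply, Complex.star_def, Complex.conj_ofReal,
    Complex.conj_mul'] at h ⊢
  exact_mod_cast h

theorem map_mulVec_dft {ι κ : Type*} [Fintype κ] (ζ : ℂ) (N : ℕ) (M : Matrix ι κ ℝ)
    (x : ℕ → κ → ℝ) (k : ℕ) :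
    M.map Complex.ofReal *ᵥ dft ζ N x k = dft ζ N (fun t => M *ᵥ x t) k := by
  ext i
  simp only [Matrix.mulVec, dotProduct, dft, Matrix.map_apply, Finset.mul_sum]
  rw [Finset.sum_comm]
  refine Finset.sum_congr rfl fun t _ => ?_
  push_cast
  rw [Finset.mul_sum]
  exact Finset.sum_congr rfl fun j _ => by ring

/-- A shift of an `N`-periodic sequence multiplies its transform by `(ζ ^ k)⁻¹`, the point of the
unit circle at which the transfer function is evaluated. -/
theorem dft_succ {ι : Type*} {ζ : ℂ} {N : ℕ} (hN : N ≠ 0) (hζ : IsPrimitiveRoot ζ N)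
    {x : ℕ → ι → ℝ} (hx : x N = x 0) (k : ℕ) :
    dft ζ N (fun t => x (t + 1)) k = (ζ ^ k)⁻¹ • dft ζ N x k := by
  ext i
  have h0 : ζ ^ k ≠ 0 := pow_ne_zero _ (hζ.ne_zero hN)
  rw [Pi.smul_apply, smul_eq_mul, eq_inv_mul_iff_mul_eq₀ h0]
  have h1 := Finset.sum_range_succ (fun t => (ζ ^ k) ^ t * (x t i : ℂ)) N
  have h2 := Finset.sum_range_succ' (fun t => (ζ ^ k) ^ t * (x t i : ℂ)) N
  have h3 : (ζ ^ k) ^ N = 1 := by rw [← pow_mul, mul_comm, pow_mul, hζ.pow_eq_one, one_pow]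
  rw [h2, hx, h3, pow_zero] at h1
  simp only [dft, Finset.mul_sum]
  rw [← add_right_cancel h1]
  exact Finset.sum_congr rfl fun t _ => by rw [pow_succ']; ring

end Fourier

section Frequency

variable {n m : ℕ} {A : Matrix (Fin n) (Fin n) ℝ} {b : Matrix (Fin n) (Fin m) ℝ}
  {Θ : Matrix (Fin n) (Fin n) ℂ} {γ : Matrix (Fin n) (Fin m) ℝ} {Γ : Matrix (Fin m) (Fin m) ℝ}

/-- On real vectors only the real part of `Θ` contributes to the form. -/
theorem form_ofReal (Θ : Matrix (Fin n) (Fin n) ℂ) (γ : Matrix (Fin n) (Fin m) ℝ)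
    (Γ : Matrix (Fin m) (Fin m) ℝ) (y : Fin n → ℝ) (u : Fin m → ℝ) :
    form Θ γ Γ (fun i => (y i : ℂ)) (fun j => (u j : ℂ))
      = runningCost (Θ.map Complex.re) γ Γ y u := by
  simp [form, runningCost, dotProduct, Matrix.mulVec]

theorem eq_transfer_mulVec (hA : ∀ l ∈ spectrum ℂ (A.map Complex.ofReal), ‖l‖ < 1) {z : ℂ}
    (hz : ‖z‖ = 1) {x v : Fin n → ℂ} (h : z • x = A.map Complex.ofReal *ᵥ x + v) :
    x = transfer A z *ᵥ v := by
  have hu : IsUnit (z • (1 : Matrix (Fin n) (Fin n) ℂ) - A.map Complex.ofReal) := by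
    have : z ∉ spectrum ℂ (A.map Complex.ofReal) := fun hs => (hA z hs).ne hz
    rw [spectrum.notMem_iff, Algebra.algebraMap_eq_smul_one] at this
    exact this
  have hv : v = (z • (1 : Matrix (Fin n) (Fin n) ℂ) - A.map Complex.ofReal) *ᵥ x := by
    rw [Matrix.sub_mulVec, Matrix.smul_mulVec, Matrix.one_mulVec, h]; abel
  rw [hv, transfer, Matrix.mulVec_mulVec,
    Matrix.nonsing_inv_mul _ ((Matrix.isUnit_iff_isUnit_det _).1 hu), Matrix.one_mulVec]

/-- The frequency inequality in the time domain, for periodic trajectories: there the discrete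
Fourier transform turns the state equation into the transfer function without boundary terms. -/
theorem periodic_cost_ge (hA : ∀ l ∈ spectrum ℂ (A.map Complex.ofReal), ‖l‖ < 1) {δ : ℝ}
    (hδ : ∀ z : ℂ, ‖z‖ = 1 → ∀ u : Fin m → ℂ, δ * ∑ j, ‖u j‖ ^ 2 ≤
      form Θ γ Γ (transfer A z *ᵥ (b.map Complex.ofReal *ᵥ u)) u)
    {N : ℕ} (hN : N ≠ 0) {y₀ : Fin n → ℝ} {u : ℕ → Fin m → ℝ}
    (hper : detState A b y₀ u N = y₀) :
    δ * ∑ t ∈ Finset.range N, u t ⬝ᵥ u t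
      ≤ ∑ t ∈ Finset.range N, runningCost (Θ.map Complex.re) γ Γ (detState A b y₀ u t) (u t) := by
  have hζ := Complex.isPrimitiveRoot_exp N hN
  set ζ := Complex.exp (2 * Real.pi * Complex.I / N)
  set y := detState A b y₀ u
  have hk : ∀ k, δ * ∑ j, ‖dft ζ N u k j‖ ^ 2
      ≤ form Θ γ Γ (dft ζ N y k) (dft ζ N u k) := fun k => by
    have hz : ‖(ζ ^ k)⁻¹‖ = 1 := by
      rw [norm_inv, norm_pow, hζ.norm'_eq_one hN, one_pow, inv_one]
    have h1 : (ζ ^ k)⁻¹ • dft ζ N y k = A.map Complex.ofReal *ᵥ dft ζ N y k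
        + b.map Complex.ofReal *ᵥ dft ζ N u k := by
      rw [← dft_succ hN hζ hper, map_mulVec_dft, map_mulVec_dft]
      ext i
      simp only [dft, Pi.add_apply, ← Finset.sum_add_distrib, ← mul_add]
      refine Finset.sum_congr rfl fun t _ => ?_
      simp [y, detState]
    rw [eq_transfer_mulVec hA hz h1]
    exact hδ _ hz _
  have h := Finset.sum_le_sum fun k (_ : k ∈ Finset.range N) => hk k
  rw [← Finset.mul_sum, sum_norm_dft_sq hζ, sum_form_dft hζ, mul_left_comm] at h
  simpa only [form_ofReal] using le_of_mul_le_mul_left h (by positivity)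

theorem detState_add (A : Matrix (Fin n) (Fin n) ℝ) (b : Matrix (Fin n) (Fin m) ℝ)
    (y w : Fin n → ℝ) (u v : ℕ → Fin m → ℝ) (t : ℕ) :
    detState A b (y + w) (u + v) t = detState A b y u t + detState A b w v t := by
  induction t with
  | zero => rfl
  | succ t ih => simp only [detState, ih, Pi.add_apply, Matrix.mulVec_add]; abel

theorem detState_smul (A : Matrix (Fin n) (Fin n) ℝ) (b : Matrix (Fin n) (Fin m) ℝ)
    (c : ℝ) (y : Fin n → ℝ) (u : ℕ → Fin m → ℝ) (t : ℕ) :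
    detState A b (c • y) (c • u) t = c • detState A b y u t := by
  induction t with
  | zero => rfl
  | succ t ih => simp only [detState, ih, Pi.smul_apply, Matrix.mulVec_smul, smul_add]

theorem detState_zero_right (A : Matrix (Fin n) (Fin n) ℝ) (b : Matrix (Fin n) (Fin m) ℝ)
    (y : Fin n → ℝ) (t : ℕ) : detState A b y 0 t = A ^ t *ᵥ y := by
  induction t with
  | zero => simp [detState]
  | succ t ih => simp [detState, ih, pow_succ', Matrix.mulVec_mulVec]

theorem zero_mem_admissible : (0 : ℕ → Fin m → ℝ) ∈ admissible m := by
  simp [admissible, summable_zero]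

/-- The powers `A ^ N` are eventually contractions. -/
theorem IsLyapunov.eventually_pow_mulVec_le {C Q : Matrix (Fin n) (Fin n) ℝ}
    (hQ : IsLyapunov A C Q) :
    ∀ᶠ N : ℕ in atTop, ∀ v, (A ^ N *ᵥ v) ⬝ᵥ (A ^ N *ᵥ v) ≤ 1 / 4 * (v ⬝ᵥ v) := by
  have hij : ∀ i j, Tendsto (fun N : ℕ => |(A ^ N) i j|) atTop (𝓝 0) := fun i j => by
    have h := (hQ.summable_detState (0 : Matrix (Fin n) (Fin 0) ℝ) (Pi.single j 1)
      zero_mem_admissible).tendsto_atTop_zero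
    simp only [detState_zero_right, Matrix.mulVec_single_one] at h
    have h2 := h.sqrt
    rw [Real.sqrt_zero] at h2
    refine squeeze_zero (fun _ => abs_nonneg _) (fun N => Real.abs_le_sqrt ?_) h2
    rw [pow_two]
    exact Finset.single_le_sum (f := fun i => (A ^ N) i j * (A ^ N) i j)
      (fun i _ => mul_self_nonneg _) (Finset.mem_univ i)
  have hsum : Tendsto (fun N : ℕ => ∑ i, ∑ j, |(A ^ N) i j|) atTop (𝓝 0) := by
    simpa using tendsto_finsetSum Finset.univ fun i _ =>
      tendsto_finsetSum Finset.univ fun j _ => hij i j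
  filter_upwards [hsum.eventually_le_const (show (0 : ℝ) < 1 / 5 by norm_num)] with N hN v
  have h1 := (le_abs_self _).trans (abs_dotProduct_mulVec_le (A ^ N) (A ^ N *ᵥ v) v)
  nlinarith [dotProduct_self_nonneg_real v, dotProduct_self_nonneg_real (A ^ N *ᵥ v)]

/-- For large `N`, a small initial state turns the zero-state response into an `N`-periodic
trajectory. -/
theorem IsLyapunov.eventually_exists_periodic {C Q : Matrix (Fin n) (Fin n) ℝ}
    (hQ : IsLyapunov A C Q) (b : Matrix (Fin n) (Fin m) ℝ) (u : ℕ → Fin m → ℝ) :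
    ∀ᶠ N in atTop, ∃ w, detState A b w u N = w ∧
      w ⬝ᵥ w ≤ 4 * (detState A b 0 u N ⬝ᵥ detState A b 0 u N) := by
  filter_upwards [hQ.eventually_pow_mulVec_le] with N hN
  -- The initial state must solve `w = A ^ N w + y N`, where `y` is the zero-state response.
  have hinj : Function.Injective (1 - A ^ N).mulVec := by
    intro v w hvw
    have h0 : (1 - A ^ N) *ᵥ (v - w) = 0 := by
      rw [Matrix.mulVec_sub]; exact sub_eq_zero.2 hvw
    rw [Matrix.sub_mulVec, Matrix.one_mulVec, sub_eq_zero] at h0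
    have h1 := hN (v - w)
    rw [← h0] at h1
    have h2 : (v - w) ⬝ᵥ (v - w) = 0 := by linarith [dotProduct_self_nonneg_real (v - w)]
    exact sub_eq_zero.1 (dotProduct_self_eq_zero.1 h2)
  obtain ⟨w, hw⟩ := Matrix.mulVec_surjective_iff_isUnit.2
    (Matrix.mulVec_injective_iff_isUnit.1 hinj) (detState A b 0 u N)
  rw [Matrix.sub_mulVec, Matrix.one_mulVec, sub_eq_iff_eq_add] at hw
  refine ⟨w, ?_, ?_⟩
  · have := detState_add A b 0 w u 0 N
    rw [zero_add, add_zero, detState_zero_right, ← hw] at this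
    exact this
  · have h1 := hN w
    have h2 := two_mul_dotProduct_le (detState A b 0 u N) (A ^ N *ᵥ w)
    have h3 : w ⬝ᵥ w = detState A b 0 u N ⬝ᵥ detState A b 0 u N
        + 2 * (detState A b 0 u N ⬝ᵥ A ^ N *ᵥ w) + (A ^ N *ᵥ w) ⬝ᵥ (A ^ N *ᵥ w) := by
      conv_lhs => rw [hw]
      rw [add_dotProduct, dotProduct_add, dotProduct_add, dotProduct_comm (A ^ N *ᵥ w)]
      ring
    linarith

/-- Young's inequality for a perturbation `h` of the state, with a free weight `s`. -/
theorem exists_runningCost_add_le {Θ : Matrix (Fin n) (Fin n) ℝ} (hΘ : Θ.IsSymm)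
    (γ : Matrix (Fin n) (Fin m) ℝ) (Γ : Matrix (Fin m) (Fin m) ℝ) :
    ∃ c, 0 ≤ c ∧ ∀ s, 0 < s → ∀ y h u, runningCost Θ γ Γ (y + h) u ≤ runningCost Θ γ Γ y u
      + c * (s ^ 2 * (y ⬝ᵥ y + u ⬝ᵥ u) + (1 + (s ^ 2)⁻¹) * (h ⬝ᵥ h)) := by
  obtain ⟨c₁, h₁, H₁⟩ := exists_abs_dotProduct_mulVec_le Θ
  obtain ⟨c₂, h₂, H₂⟩ := exists_abs_dotProduct_mulVec_le γ
  refine ⟨2 * c₁ + 2 * c₂, by positivity, fun s hs y h u => ?_⟩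
  have e : runningCost Θ γ Γ (y + h) u = runningCost Θ γ Γ y u + 2 * (h ⬝ᵥ Θ *ᵥ y)
      + h ⬝ᵥ Θ *ᵥ h + 2 * (h ⬝ᵥ γ *ᵥ u) := by
    simp only [runningCost, quadratic_add hΘ, add_dotProduct]
    ring
  have k1 := (le_abs_self _).trans (H₁ (s⁻¹ • h) (s • y))
  have k2 := (le_abs_self _).trans (H₂ (s⁻¹ • h) (s • u))
  have k3 := (le_abs_self _).trans (H₁ h h)
  simp only [Matrix.mulVec_smul, smul_dotProduct, dotProduct_smul, smul_eq_mul, ← mul_assoc,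
    mul_inv_cancel₀ hs.ne', one_mul, ← pow_two, ← inv_pow] at k1 k2 k3 ⊢
  have hh := dotProduct_self_nonneg_real h
  have hy := mul_nonneg (sq_nonneg s) (dotProduct_self_nonneg_real y)
  have hu := mul_nonneg (sq_nonneg s) (dotProduct_self_nonneg_real u)
  have hi := mul_nonneg (sq_nonneg s⁻¹) hh
  rw [e]
  nlinarith [mul_nonneg h₁ hu, mul_nonneg h₂ hy, mul_nonneg h₂ hh, mul_nonneg h₁ hh]

/-- The frequency inequality in the time domain, for trajectories starting at the origin. -/
theorem cost_zero_state_ge (hA : ∀ l ∈ spectrum ℂ (A.map Complex.ofReal), ‖l‖ < 1) {δ : ℝ}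
    (hδ : ∀ z : ℂ, ‖z‖ = 1 → ∀ u : Fin m → ℂ, δ * ∑ j, ‖u j‖ ^ 2 ≤
      form Θ γ Γ (transfer A z *ᵥ (b.map Complex.ofReal *ᵥ u)) u)
    (hΘ : (Θ.map Complex.re).IsSymm) {C Q : Matrix (Fin n) (Fin n) ℝ} (hQ : IsLyapunov A C Q)
    {u : ℕ → Fin m → ℝ} (hu : u ∈ admissible m) :
    δ * ∑' t, u t ⬝ᵥ u t
      ≤ ∑' t, runningCost (Θ.map Complex.re) γ Γ (detState A b 0 u t) (u t) := by
  set y := detState A b 0 u with hy_def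
  set R := runningCost (Θ.map Complex.re) γ Γ
  have hy : Summable fun t => y t ⬝ᵥ y t := hQ.summable_detState b 0 hu
  have hR : Summable fun t => R (y t) (u t) := summable_runningCost _ γ Γ hy hu
  obtain ⟨c, hc, Hc⟩ := exists_runningCost_add_le hΘ γ Γ
  obtain ⟨d, hd, Hd⟩ := hQ.exists_tsum_detState_le b
  set B := ∑' t, (y t ⬝ᵥ y t + u t ⬝ᵥ u t)
  have hyu : ∀ t, 0 ≤ y t ⬝ᵥ y t + u t ⬝ᵥ u t := fun t =>
    add_nonneg (dotProduct_self_nonneg_real _) (dotProduct_self_nonneg_real _)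
  have hB : 0 ≤ B := tsum_nonneg hyu
  -- The periodic correction `A ^ t w` vanishes as `N → ∞`; the weight `s` of its products with the
  -- trajectory is sent to zero afterwards.
  have key : ∀ s, 0 < s → δ * ∑' t, u t ⬝ᵥ u t ≤ ∑' t, R (y t) (u t) + c * (s ^ 2 * B) := by
    intro s hs
    have hev : ∀ᶠ N in atTop, δ * ∑ t ∈ Finset.range N, u t ⬝ᵥ u t
        ≤ ∑ t ∈ Finset.range N, R (y t) (u t)
          + c * (s ^ 2 * B + (1 + (s ^ 2)⁻¹) * (d * (4 * (y N ⬝ᵥ y N)))) := by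
      filter_upwards [hQ.eventually_exists_periodic b u, eventually_ne_atTop 0]
        with N ⟨w, hw, hwy⟩ hN
      refine (periodic_cost_ge hA hδ hN hw).trans ?_
      have hsplit : ∀ t, detState A b w u t = y t + detState A b w 0 t := fun t => by
        have := detState_add A b 0 w u 0 t
        rwa [zero_add, add_zero] at this
      have hfree := Hd w 0 zero_mem_admissible
      simp only [Pi.zero_apply, dotProduct_zero, tsum_zero, add_zero] at hfree
      have h1 : ∑ t ∈ Finset.range N, detState A b w 0 t ⬝ᵥ detState A b w 0 t
          ≤ d * (4 * (y N ⬝ᵥ y N)) :=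
        (hfree.1.sum_le_tsum _ fun t _ => dotProduct_self_nonneg_real _).trans
          (hfree.2.trans (mul_le_mul_of_nonneg_left hwy hd))
      have h2 : ∑ t ∈ Finset.range N, (y t ⬝ᵥ y t + u t ⬝ᵥ u t) ≤ B :=
        (hy.add hu).sum_le_tsum _ fun t _ => hyu t
      calc ∑ t ∈ Finset.range N, R (detState A b w u t) (u t)
          ≤ ∑ t ∈ Finset.range N, (R (y t) (u t) + c * (s ^ 2 * (y t ⬝ᵥ y t + u t ⬝ᵥ u t)
            + (1 + (s ^ 2)⁻¹) * (detState A b w 0 t ⬝ᵥ detState A b w 0 t))) :=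
            Finset.sum_le_sum fun t _ => by rw [hsplit]; exact Hc s hs _ _ _
        _ = ∑ t ∈ Finset.range N, R (y t) (u t)
            + c * (s ^ 2 * ∑ t ∈ Finset.range N, (y t ⬝ᵥ y t + u t ⬝ᵥ u t)
              + (1 + (s ^ 2)⁻¹) *
                ∑ t ∈ Finset.range N, detState A b w 0 t ⬝ᵥ detState A b w 0 t) := by
            rw [Finset.sum_add_distrib, ← Finset.mul_sum, Finset.sum_add_distrib,
              ← Finset.mul_sum, ← Finset.mul_sum]
        _ ≤ _ := by gcongr
    have hlim := hR.hasSum.tendsto_sum_nat.add (((((hy.tendsto_atTop_zero.const_mul 4).const_mul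
      d).const_mul (1 + (s ^ 2)⁻¹)).const_add (s ^ 2 * B)).const_mul c)
    simp only [mul_zero, add_zero] at hlim
    exact le_of_tendsto_of_tendsto (hu.hasSum.tendsto_sum_nat.const_mul δ) hlim hev
  have hlim : Tendsto (fun s : ℝ => ∑' t, R (y t) (u t) + c * (s ^ 2 * B)) (𝓝[>] 0)
      (𝓝 (∑' t, R (y t) (u t) + c * (0 ^ 2 * B))) :=
    ((by fun_prop : Continuous fun s : ℝ => ∑' t, R (y t) (u t) + c * (s ^ 2 * B)).tendsto
      0).mono_left nhdsWithin_le_nhds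
  have := ge_of_tendsto hlim (eventually_nhdsWithin_of_forall fun s hs => key s hs)
  simpa using this

end Frequency

/-! ### Minimisation in the Hilbert space of square-summable controls -/

section Minimisation

open scoped InnerProductSpace

/-- A quadratic functional `u ↦ q (y₀ + S u, u)` on a Hilbert space whose homogeneous part
`q (S u, u)` is coercive has a stationary point, around which it is given by that part. -/
theorem exists_quadratic_stationary {H K : Type*} [NormedAddCommGroup H] [InnerProductSpace ℝ H]
    [CompleteSpace H] [NormedAddCommGroup K] [InnerProductSpace ℝ K] [CompleteSpace K]
    (S : H →L[ℝ] K) (Θ : K →L[ℝ] K) (γ : H →L[ℝ] K) (Γ : H →L[ℝ] H) (y₀ : K)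
    (hΘ : ∀ x y, ⟪Θ x, y⟫_ℝ = ⟪x, Θ y⟫_ℝ) (hΓ : ∀ x y, ⟪Γ x, y⟫_ℝ = ⟪x, Γ y⟫_ℝ)
    (q : K → H → ℝ) (hq : ∀ y u, q y u = ⟪y, Θ y⟫_ℝ + 2 * ⟪y, γ u⟫_ℝ + ⟪u, Γ u⟫_ℝ)
    {δ : ℝ} (hδ : 0 < δ) (hpos : ∀ u, δ * ‖u‖ ^ 2 ≤ q (S u) u) :
    ∃ u₀, ∀ u, q (y₀ + S u) u = q (y₀ + S u₀) u₀ + q (S (u - u₀)) (u - u₀) := by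
  -- The operator of the homogeneous part; a stationary point solves `R u = -(S† Θ y₀ + γ† y₀)`.
  let R : H →L[ℝ] H := S.adjoint ∘L Θ ∘L S + S.adjoint ∘L γ + γ.adjoint ∘L S + Γ
  have hR : ∀ u v, ⟪R u, v⟫_ℝ = ⟪Θ (S u), S v⟫_ℝ + ⟪γ u, S v⟫_ℝ + ⟪S u, γ v⟫_ℝ + ⟪Γ u, v⟫_ℝ := by
    intro u v
    simp [R, inner_add_left, ContinuousLinearMap.adjoint_inner_left]
  have hcoer : IsCoercive ((innerSL ℝ : H →L[ℝ] H →L[ℝ] ℝ) ∘L R) := by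
    refine ⟨δ, hδ, fun u => ?_⟩
    have h := hpos u
    rw [hq] at h
    rw [ContinuousLinearMap.comp_apply, innerSL_apply_apply, hR, hΘ, hΓ,
      real_inner_comm (S u) (γ u)]
    nlinarith
  let e := hcoer.continuousLinearEquivOfBilin
  have he : ∀ v w, ⟪e v, w⟫_ℝ = ⟪R v, w⟫_ℝ := fun v w => by
    rw [hcoer.continuousLinearEquivOfBilin_apply]; rfl
  obtain ⟨u₀, hu₀⟩ := e.surjective (-(S.adjoint (Θ y₀) + γ.adjoint y₀))
  refine ⟨u₀, fun u => ?_⟩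
  have h0 := he u₀ (u - u₀)
  rw [hu₀, inner_neg_left, inner_add_left, ContinuousLinearMap.adjoint_inner_left,
    ContinuousLinearMap.adjoint_inner_left, hR] at h0
  obtain ⟨h, rfl⟩ : ∃ h, u = u₀ + h := ⟨u - u₀, by abel⟩
  rw [add_sub_cancel_left] at h0 ⊢
  simp only [hq, map_add, inner_add_left, inner_add_right]
  have c1 := hΘ y₀ (S h)
  have c2 := hΘ (S u₀) (S h)
  have c3 := hΓ u₀ h
  have c4 := real_inner_comm (S h) (γ u₀)
  have c5 := real_inner_comm (S h) (Θ y₀)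
  have c6 := real_inner_comm (S h) (Θ (S u₀))
  have c7 := real_inner_comm h (Γ u₀)
  linarith

/-- The Hilbert space of square-summable sequences in `ℝᵏ`. -/
abbrev SeqSpace (k : ℕ) : Type := lp (fun _ : ℕ => EuclideanSpace ℝ (Fin k)) 2

/-- An element of the Hilbert space as a plain sequence of coordinate vectors. -/
def SeqSpace.toSeq {k : ℕ} (u : SeqSpace k) (t : ℕ) : Fin k → ℝ := (u t).ofLp

theorem euclidean_norm_sq {k : ℕ} (x : EuclideanSpace ℝ (Fin k)) : ‖x‖ ^ 2 = x.ofLp ⬝ᵥ x.ofLp := by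
  rw [EuclideanSpace.real_norm_sq_eq]
  simp [dotProduct, pow_two]

theorem SeqSpace.toSeq_mem {k : ℕ} (u : SeqSpace k) : u.toSeq ∈ admissible k := by
  have := (lp.memℓp u).summable (by norm_num)
  simp only [ENNReal.toReal_ofNat, Real.rpow_ofNat, euclidean_norm_sq] at this
  exact this

theorem SeqSpace.hasSum_inner {k : ℕ} (u v : SeqSpace k) :
    HasSum (fun t => u.toSeq t ⬝ᵥ v.toSeq t) ⟪u, v⟫_ℝ := by
  refine (lp.hasSum_inner u v).congr_fun ?_
  intro t
  rw [EuclideanSpace.inner_eq_star_dotProduct, dotProduct_comm]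
  rfl

theorem SeqSpace.norm_sq_eq {k : ℕ} (u : SeqSpace k) : ‖u‖ ^ 2 = ∑' t, u.toSeq t ⬝ᵥ u.toSeq t := by
  rw [← real_inner_self_eq_norm_sq, (u.hasSum_inner u).tsum_eq]

theorem SeqSpace.toSeq_injective {k : ℕ} : Function.Injective (SeqSpace.toSeq (k := k)) := by
  intro u v h
  refine lp.ext (funext fun t => ?_)
  exact WithLp.ofLp_injective 2 (congrFun h t)

theorem SeqSpace.exists_toSeq_eq {k : ℕ} {u : ℕ → Fin k → ℝ} (hu : u ∈ admissible k) :
    ∃ v : SeqSpace k, v.toSeq = u := by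
  refine ⟨⟨fun t => WithLp.toLp 2 (u t), memℓp_gen ?_⟩, rfl⟩
  simp only [ENNReal.toReal_ofNat, Real.rpow_ofNat, euclidean_norm_sq]
  exact hu

/-- A linear map on sequences that is bounded in the square-sum norm acts on the Hilbert space. -/
theorem SeqSpace.exists_continuousLinearMap {p q : ℕ} {f : (ℕ → Fin q → ℝ) → ℕ → Fin p → ℝ}
    (hadd : ∀ u v, f (u + v) = f u + f v) (hsmul : ∀ (c : ℝ) u, f (c • u) = c • f u)
    {c : ℝ} (hc : 0 ≤ c) (hf : ∀ u ∈ admissible q, f u ∈ admissible p ∧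
      ∑' t, f u t ⬝ᵥ f u t ≤ c * ∑' t, u t ⬝ᵥ u t) :
    ∃ T : SeqSpace q →L[ℝ] SeqSpace p, ∀ u, (T u).toSeq = f u.toSeq := by
  choose g hg using fun u : SeqSpace q => SeqSpace.exists_toSeq_eq (hf u.toSeq u.toSeq_mem).1
  let L : SeqSpace q →ₗ[ℝ] SeqSpace p :=
    { toFun := g
      map_add' := fun u v => SeqSpace.toSeq_injective (by
        have : (g u + g v).toSeq = (g u).toSeq + (g v).toSeq := rfl
        rw [this, hg, hg, hg, ← hadd]; rfl)
      map_smul' := fun r u => SeqSpace.toSeq_injective (by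
        have : (r • g u).toSeq = r • (g u).toSeq := rfl
        rw [RingHom.id_apply, this, hg, hg, ← hsmul]; rfl) }
  refine ⟨L.mkContinuous (Real.sqrt c) fun u => ?_, hg⟩
  refine abs_le_of_sq_le_sq' ?_ (by positivity) |>.2
  rw [mul_pow, Real.sq_sqrt hc, SeqSpace.norm_sq_eq, SeqSpace.norm_sq_eq]
  have : (L u).toSeq = f u.toSeq := hg u
  rw [this]
  exact (hf u.toSeq u.toSeq_mem).2

theorem SeqSpace.exists_mulVec {p q : ℕ} (M : Matrix (Fin p) (Fin q) ℝ) :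
    ∃ T : SeqSpace q →L[ℝ] SeqSpace p, ∀ u t, (T u).toSeq t = M *ᵥ u.toSeq t := by
  obtain ⟨c, hc, h⟩ := exists_mulVec_dotProduct_self_le M
  obtain ⟨T, hT⟩ := SeqSpace.exists_continuousLinearMap (f := fun u t => M *ᵥ u t)
    (fun u v => funext fun t => Matrix.mulVec_add _ _ _)
    (fun r u => funext fun t => Matrix.mulVec_smul M r (u t)) hc fun u hu => by
      have hs : Summable fun t => (M *ᵥ u t) ⬝ᵥ (M *ᵥ u t) :=
        .of_nonneg_of_le (fun t => dotProduct_self_nonneg_real _) (fun t => h (u t))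
          (hu.mul_left c)
      refine ⟨hs, ?_⟩
      rw [← tsum_mul_left]
      exact hs.tsum_le_tsum (fun t => h (u t)) (hu.mul_left c)
  exact ⟨T, fun u t => congrFun (hT u) t⟩

variable {n m : ℕ} {A : Matrix (Fin n) (Fin n) ℝ} {b : Matrix (Fin n) (Fin m) ℝ}
  {Θ : Matrix (Fin n) (Fin n) ℝ} {γ : Matrix (Fin n) (Fin m) ℝ} {Γ : Matrix (Fin m) (Fin m) ℝ}

/-- If the cost is coercive along trajectories from the origin, then it is minimised, for any
initial state, by some control, and its excess over the minimum is the zero-state cost of the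
deviation. -/
theorem exists_optimal_of_coercive {C Q : Matrix (Fin n) (Fin n) ℝ} (hQ : IsLyapunov A C Q)
    (hΘ : Θ.IsSymm) (hΓ : Γ.IsSymm) {δ : ℝ} (hδ : 0 < δ)
    (hpos : ∀ u ∈ admissible m, δ * ∑' t, u t ⬝ᵥ u t
      ≤ ∑' t, runningCost Θ γ Γ (detState A b 0 u t) (u t)) (y₀ : Fin n → ℝ) :
    ∃ u₀ ∈ admissible m, ∀ u ∈ admissible m, u - u₀ ∈ admissible m ∧
      ∑' t, runningCost Θ γ Γ (detState A b y₀ u t) (u t)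
        = ∑' t, runningCost Θ γ Γ (detState A b y₀ u₀ t) (u₀ t)
          + ∑' t, runningCost Θ γ Γ (detState A b 0 (u - u₀) t) ((u - u₀) t) := by
  obtain ⟨c, hc, h⟩ := hQ.exists_tsum_detState_le b
  obtain ⟨S, hS⟩ := SeqSpace.exists_continuousLinearMap (f := detState A b 0)
    (fun u v => funext fun t => by simpa using detState_add A b 0 0 u v t)
    (fun r u => funext fun t => by simpa using detState_smul A b r 0 u t) hc fun u hu => by
      simpa [admissible] using h 0 u hu
  obtain ⟨TΘ, hTΘ⟩ := SeqSpace.exists_mulVec Θ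
  obtain ⟨Tγ, hTγ⟩ := SeqSpace.exists_mulVec γ
  obtain ⟨TΓ, hTΓ⟩ := SeqSpace.exists_mulVec Γ
  obtain ⟨z, hz⟩ := SeqSpace.exists_toSeq_eq (hQ.summable_detState b y₀ zero_mem_admissible)
  have hsymm : ∀ {k : ℕ} {M : Matrix (Fin k) (Fin k) ℝ} {T : SeqSpace k →L[ℝ] SeqSpace k},
      M.IsSymm → (∀ u t, (T u).toSeq t = M *ᵥ u.toSeq t) → ∀ x y, ⟪T x, y⟫_ℝ = ⟪x, T y⟫_ℝ := by
    intro k M T hM hT x y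
    rw [← ((T x).hasSum_inner y).tsum_eq, ← (x.hasSum_inner (T y)).tsum_eq]
    refine tsum_congr fun t => ?_
    rw [hT, hT, dotProduct_comm, dotProduct_mulVec_comm_of_isSymm hM]
  have hq : ∀ (y : SeqSpace n) (u : SeqSpace m),
      ∑' t, runningCost Θ γ Γ (y.toSeq t) (u.toSeq t)
        = ⟪y, TΘ y⟫_ℝ + 2 * ⟪y, Tγ u⟫_ℝ + ⟪u, TΓ u⟫_ℝ := fun y u => by
    have := (((y.hasSum_inner (TΘ y)).add ((y.hasSum_inner (Tγ u)).mul_left 2)).add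
      (u.hasSum_inner (TΓ u))).tsum_eq
    simpa only [hTΘ, hTγ, hTΓ, runningCost] using this
  have hstate : ∀ u : SeqSpace m, ∀ t, (z + S u).toSeq t = detState A b y₀ u.toSeq t := by
    intro u t
    have h1 : (z + S u).toSeq t = z.toSeq t + (S u).toSeq t := rfl
    have h2 := detState_add A b y₀ 0 0 u.toSeq t
    rw [add_zero, zero_add] at h2
    rw [h1, hz, hS, h2]
  obtain ⟨u₀, hu₀⟩ := exists_quadratic_stationary S TΘ Tγ TΓ z (hsymm hΘ hTΘ) (hsymm hΓ hTΓ)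
    _ hq hδ fun u => by
      rw [SeqSpace.norm_sq_eq, hS]
      exact hpos _ u.toSeq_mem
  refine ⟨u₀.toSeq, u₀.toSeq_mem, fun u hu => ?_⟩
  obtain ⟨v, rfl⟩ := SeqSpace.exists_toSeq_eq hu
  have hsub : v.toSeq - u₀.toSeq = (v - u₀).toSeq := rfl
  rw [hsub]
  refine ⟨(v - u₀).toSeq_mem, ?_⟩
  have := hu₀ v
  simpa only [hstate, hS] using this

end Minimisation

/-! ### Real parts of the Lyapunov equations and the theorem -/

section RealParts

variable {n : ℕ}

theorem map_re_ofReal_conj (A : Matrix (Fin n) (Fin n) ℝ) (H : Matrix (Fin n) (Fin n) ℂ) :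
    ((A.map Complex.ofReal)ᵀ * H * A.map Complex.ofReal).map Complex.re
      = Aᵀ * H.map Complex.re * A := by
  ext i j
  simp [Matrix.mul_apply]

/-- The real parts of a complex solution of the Lyapunov equations form a real solution. -/
theorem LyapunovPair.re {A C G : Matrix (Fin n) (Fin n) ℝ} {H Θ : Matrix (Fin n) (Fin n) ℂ}
    (h : LyapunovPair A C G H Θ) :
    (H.map Complex.re).IsSymm ∧ (Θ.map Complex.re).IsSymm ∧
      Aᵀ * H.map Complex.re * A - H.map Complex.re + Θ.map Complex.re = 0 ∧
      Θ.map Complex.re - Cᵀ * H.map Complex.re * C - G = 0 := by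
  refine ⟨h.symm_H.map _, h.symm_Θ.map _, ?_, ?_⟩
  · rw [← map_re_ofReal_conj]
    ext i j
    simpa using congrArg (fun M : Matrix (Fin n) (Fin n) ℂ => (M i j).re) h.eq₁
  · rw [← map_re_ofReal_conj]
    ext i j
    simpa using congrArg (fun M : Matrix (Fin n) (Fin n) ℂ => (M i j).re) h.eq₂

end RealParts

/-- Costs that differ by a constant on the admissible controls have the same minimisers. -/
theorem isOptimal_congr {m : ℕ} {J J' : (ℕ → Fin m → ℝ) → ℝ} {K : ℝ}
    (h : ∀ u ∈ admissible m, J u = J' u + K) (u : ℕ → Fin m → ℝ) :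
    IsOptimal J u ↔ IsOptimal J' u := by
  refine and_congr_right fun hu => forall₂_congr fun v hv => ?_
  rw [h u hu, h v hv, add_le_add_iff_right]

end LQ

theorem theorem2 {Ω : Type*} [mΩ : MeasurableSpace Ω] (P : Measure Ω) [IsProbabilityMeasure P]
    (ℱ : Filtration ℕ mΩ) (ξ : ℕ → Ω → ℝ) (hξ : LQ.IsWhiteNoise P ℱ ξ)
    {n m : ℕ} (a : Ω → Fin n → ℝ) (ha : LQ.IsInitialState P ℱ ξ a)
    (A : Matrix (Fin n) (Fin n) ℝ) (b : Matrix (Fin n) (Fin m) ℝ)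
    (C G : Matrix (Fin n) (Fin n) ℝ) (γ : Matrix (Fin n) (Fin m) ℝ)
    (Γ : Matrix (Fin m) (Fin m) ℝ) (hG : G.IsSymm) (hΓ : Γ.IsSymm)
    (hA : ∀ l ∈ spectrum ℂ (A.map Complex.ofReal), ‖l‖ < 1)
    (hstab : LQ.MeanSquareStable P ℱ ξ A C)
    (H Θ : Matrix (Fin n) (Fin n) ℂ) (hΘ : LQ.LyapunovPair A C G H Θ) :
    -- both costs are well defined: all expectations exist and both series converge absolutely
    (∀ u ∈ LQ.admissible m,
      (∀ t, Integrable (fun ω => LQ.runningCost G γ Γ (LQ.state A b C ξ a u t ω) (u t)) P) ∧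
      Summable (fun t => ∫ ω, LQ.runningCost G γ Γ (LQ.state A b C ξ a u t ω) (u t) ∂P) ∧
      Summable (LQ.detRunningCost (∫ ω, a ω ∂P) A b Θ γ Γ u)) ∧
    -- an optimal control exists for one problem if and only if it exists for the other
    ((∃ u, LQ.IsOptimal (LQ.stochCost P ξ a A b C G γ Γ) u) ↔
      ∃ u, LQ.IsOptimal (LQ.detCost (∫ ω, a ω ∂P) A b Θ γ Γ) u) ∧
    -- under the strict frequency inequality both problems have the same unique optimal control
    (LQ.StrictFrequency A b Θ γ Γ →
      ∃ u₀, (∀ u, LQ.IsOptimal (LQ.stochCost P ξ a A b C G γ Γ) u ↔ u = u₀) ∧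
        ∀ u, LQ.IsOptimal (LQ.detCost (∫ ω, a ω ∂P) A b Θ γ Γ) u ↔ u = u₀) := by
  obtain ⟨Q, hQ⟩ := LQ.exists_isLyapunov hξ hstab
  obtain ⟨hH', hΘ', h₁, h₂⟩ := hΘ.re
  have hform : ∀ u t, LQ.detRunningCost (∫ ω, a ω ∂P) A b Θ γ Γ u t
      = LQ.runningCost (Θ.map Complex.re) γ Γ (LQ.detState A b (∫ ω, a ω ∂P) u t) (u t) :=
    fun u t => LQ.form_ofReal Θ γ Γ _ _
  have hdet : ∀ u, LQ.detCost (∫ ω, a ω ∂P) A b Θ γ Γ u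
      = ∑' t, LQ.runningCost (Θ.map Complex.re) γ Γ
          (LQ.detState A b (∫ ω, a ω ∂P) u t) (u t) := fun u => tsum_congr (hform u)
  obtain ⟨K, hK⟩ := LQ.exists_stochCost_eq hξ ha A C G b γ Γ hQ hH' h₁ h₂
  have hiff := LQ.isOptimal_congr (J := LQ.stochCost P ξ a A b C G γ Γ)
    (J' := LQ.detCost (∫ ω, a ω ∂P) A b Θ γ Γ) (K := K)
    fun u hu => by rw [hK u hu, hdet]
  refine ⟨fun u hu => ⟨fun t => LQ.integrable_runningCost hξ ha A C G b γ Γ t,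
    LQ.summable_integral_runningCost hξ ha A C G b γ Γ hQ hu, ?_⟩,
    exists_congr hiff, ?_⟩
  · exact (LQ.summable_runningCost _ γ Γ (hQ.summable_detState b _ hu) hu).congr
      fun t => (hform u t).symm
  rintro ⟨δ, hδ, hfreq⟩
  have hpos := fun u (hu : u ∈ LQ.admissible m) => LQ.cost_zero_state_ge hA hfreq hΘ' hQ hu
  obtain ⟨u₀, hu₀, hopt⟩ :=
    LQ.exists_optimal_of_coercive hQ hΘ' hΓ hδ hpos (∫ ω, a ω ∂P)
  have huniq : ∀ u, LQ.IsOptimal (LQ.detCost (∫ ω, a ω ∂P) A b Θ γ Γ) u ↔ u = u₀ := by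
    intro u
    constructor
    · rintro ⟨hu, hmin⟩
      have h := hmin u₀ hu₀
      obtain ⟨hsub, e⟩ := hopt u hu
      rw [hdet, hdet, e] at h
      -- The zero-state cost of `u - u₀` is nonpositive, so coercivity forces `u = u₀`.
      have hz := hpos _ hsub
      have hle : ∑' t, (u - u₀) t ⬝ᵥ (u - u₀) t ≤ 0 := by nlinarith
      have hnn : ∀ t, 0 ≤ (u - u₀) t ⬝ᵥ (u - u₀) t := fun t => LQ.dotProduct_self_nonneg_real _
      have h0 := (hasSum_zero_iff_of_nonneg hnn).1
        ((le_antisymm hle (tsum_nonneg hnn)) ▸ Summable.hasSum hsub)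
      exact sub_eq_zero.1 (funext fun t => dotProduct_self_eq_zero.1 (congrFun h0 t))
    · rintro rfl
      refine ⟨hu₀, fun v hv => ?_⟩
      obtain ⟨hsub, e⟩ := hopt v hv
      rw [hdet, hdet, e]
      have := (mul_nonneg hδ.le (tsum_nonneg fun t =>
        LQ.dotProduct_self_nonneg_real ((v - u) t))).trans (hpos _ hsub)
      linarith
  exact ⟨u₀, fun u => (hiff u).trans (huniq u), huniq⟩
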